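/- An approval election consists of a finite set $V$ of $n$ voters, a finite set $C$ of $m$ candidates, a ballot $A_v\subseteq C$ for every $v\in V$, and a committee size $k$ with $1\le k\le m$; write $V_c=\{v\in V: c\in A_v\}$. It is in the *voter-candidate interval (VCI) domain* if there are reals $x_v,x_c$ and $r_v,r_c\ge 0$ ($v\in V$, $c\in C$) such that $c\in A_v \iff |x_c-x_v|\le r_c+r_v$ for all $v,c$; it is in the *candidate interval (CI) domain* if the candidates can be ordered so that every ballot is a (possibly empty) interval of the ordering. For $W\subseteq C$ let $$\mathrm{CC}(W)=|\{v\in V: A_v\cap W\ne\emptyset\}|,\qquad \mathrm{Pairs}(W)=|\{\{u,v\}\subseteq V: u\ne v,\ A_u\cap A_v\cap W\neq\emptyset\}|.$$ The *pair instance* has as voters the two-element subsets $\{u,v\}$ of $V$, with ballots $A_u\cap A_v$, and the same candidates and $k$. A candidate $c'$ is *dominated* if $V_{c'}\subsetneq V_c$ for some candidate $c$. Say that $W$ *maximizes* a score $S$ if $|W|=k$ and $S(W)\ge S(U)$ for all $U\subseteq C$ with $|U|\le k$. Then: 1. There is an algorithm that, given the approval matrix of an election in the VCI domain and $k$ (but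 no positions, radii or candidate ordering), computes a committee maximizing $\mathrm{Pairs}$ in time polynomial in $n+m$. 2. Deleting all dominated candidates from an approval profile in the VCI domain yields a profile in the CI domain. 3. For every election and every $W\subseteq C$, $\mathrm{Pairs}(W)$ equals the $\mathrm{CC}$ score of $W$ in the pair instance. 4. If an election is in the CI domain, then so is its pair instance. 5. There is an algorithm that, given the approval matrix of an election in the CI domain and $k$ (but no candidate ordering), computes a committee maximizing $\mathrm{CC}$ in time polynomial in $n+m$. Running time is the number of steps of a random access machine whose arithmetic is addition and truncated subtraction at unit cost. -/

import Mathlib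

/-- The voters approving candidate `c` (the hyperedge `V_c`) in the approval profile `A`. -/
def supporters {V C : Type*} (A : V → Finset C) (c : C) : Set V := {v | c ∈ A v}

/-- Candidate `d` is dominated: its supporters are a proper subset of another one's. -/
def IsDominated {V C : Type*} (A : V → Finset C) (d : C) : Prop :=
  ∃ c, supporters A d ⊂ supporters A c

open Classical in
/-- The profile obtained by deleting all dominated candidates. -/
noncomputable def removeDominated {V C : Type*} (A : V → Finset C) :
    V → Finset {c : C // ¬ IsDominated A c} :=
  fun v => (A v).subtype (fun c => ¬ IsDominated A c)

/-- The voter-candidate interval domain: voter `v` approves candidate `c` if and only if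
`|x_c - x_v| ≤ r_c + r_v`, for suitable real positions and nonnegative radii. -/
def IsVCI {V C : Type*} (A : V → Finset C) : Prop :=
  ∃ (xV rV : V → ℝ) (xC rC : C → ℝ),
    (∀ v, 0 ≤ rV v) ∧ (∀ c, 0 ≤ rC c) ∧
      ∀ v c, c ∈ A v ↔ |xC c - xV v| ≤ rC c + rV v

/-- The candidate interval domain: for some ordering of the candidates every ballot is an
interval (possibly empty: `i` may exceed `j`). -/
def IsCI {V C : Type*} (A : V → Finset C) : Prop :=
  ∃ (m : ℕ) (σ : C ≃ Fin m), ∀ v, ∃ i j : ℕ, ∀ c,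
    c ∈ A v ↔ i ≤ (σ c : ℕ) ∧ (σ c : ℕ) ≤ j

/-- An election instance `(V, A, k)` over the finite candidate set `C`, with `1 ≤ k ≤ |C|`. -/
structure Election (V C : Type*) [Fintype C] where
  /-- the approval profile -/
  A : V → Finset C
  /-- the target committee size -/
  k : ℕ
  one_le_k : 1 ≤ k
  k_le_card : k ≤ Fintype.card C

namespace Election

variable {V C : Type*} [Fintype V] [Fintype C] [DecidableEq V] [DecidableEq C]

/-- The Chamberlin-Courant score: the number of voters approving some member of `W`. -/
def cc {V C : Type*} [Fintype V] [Fintype C] [DecidableEq C]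
    (E : Election V C) (W : Finset C) : ℕ :=
  (Finset.univ.filter (fun v => (E.A v ∩ W).Nonempty)).card

/-- The Pairs score: the number of two-element sets `{u, v}` of voters such that
`A_u ∩ A_v ∩ W` is nonempty. -/
def pairs (E : Election V C) (W : Finset C) : ℕ :=
  ((Finset.univ.powersetCard 2).filter
    (fun p : Finset V => ∃ u v, p = {u, v} ∧ (E.A u ∩ E.A v ∩ W).Nonempty)).card

/-- The associated pair instance: its voters are the two-element sets `p` of voters, and `p`
approves the candidates that both of its elements approve. -/
def pairInstance {V C : Type*} [Fintype C] [DecidableEq C] (E : Election V C) :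
    Election {p : Finset V // p.card = 2} C where
  A p := Finset.univ.filter (fun c => ∀ v ∈ p.1, c ∈ E.A v)
  k := E.k
  one_le_k := E.one_le_k
  k_le_card := E.k_le_card

/-- `W` has size exactly `k` and maximizes the score `S` over all committees of size at
most `k`. -/
def IsMaximizer {V C : Type*} [Fintype C] (E : Election V C) (S : Finset C → ℕ)
    (W : Finset C) : Prop :=
  W.card = E.k ∧ ∀ U : Finset C, U.card ≤ E.k → S U ≤ S W

end Election

/-! Machine model: a random access machine with finitely many integer variables and finitely
many two-dimensional arrays (each program mentions finitely many of them), running structured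
programs. The only arithmetic is addition and truncated subtraction, and every instruction and
every test costs one step. In particular the bit length of any stored number grows by at most
one per step, so that polynomial time on this machine is ordinary polynomial time. -/

namespace RAM

/-- Memory contents: the variables, and the arrays (named by the first index). -/
structure State where
  var : ℕ → ℕ
  arr : ℕ → ℕ → ℕ → ℕ

/-- Overwrite the variable `x`. -/
def State.setVar (s : State) (x val : ℕ) : State where
  var y := if y = x then val else s.var y
  arr := s.arr

/-- Overwrite the entry `(i, j)` of the array `a`. -/
def State.setArr (s : State) (a i j val : ℕ) : State where
  var := s.var
  arr b p q := if b = a ∧ p = i ∧ q = j then val else s.arr b p q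

/-- Programs. In `load` and `store` the array is fixed by the program, while the two
indices are the current values of variables. -/
inductive Prog where
  | skip : Prog
  /-- `x := c`, for a constant `c` -/
  | const (x c : ℕ) : Prog
  /-- `x := y + z` -/
  | add (x y z : ℕ) : Prog
  /-- `x := y - z`, truncated at zero -/
  | sub (x y z : ℕ) : Prog
  /-- `x := a[i, j]` -/
  | load (x a i j : ℕ) : Prog
  /-- `a[i, j] := x` -/
  | store (a i j x : ℕ) : Prog
  | seq (p q : Prog) : Prog
  /-- if `x` is nonzero then `p` else `q` -/
  | ite (x : ℕ) (p q : Prog) : Prog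
  /-- while `x` is nonzero do `p` -/
  | loop (x : ℕ) (p : Prog) : Prog

/-- `Exec p s t r`: started in memory `s`, the program `p` halts after exactly `t` steps, in
memory `r`. -/
inductive Exec : Prog → State → ℕ → State → Prop where
  | skip (s : State) : Exec .skip s 1 s
  | const (s : State) (x c : ℕ) : Exec (.const x c) s 1 (s.setVar x c)
  | add (s : State) (x y z : ℕ) : Exec (.add x y z) s 1 (s.setVar x (s.var y + s.var z))
  | sub (s : State) (x y z : ℕ) : Exec (.sub x y z) s 1 (s.setVar x (s.var y - s.var z))
  | load (s : State) (x a i j : ℕ) :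
      Exec (.load x a i j) s 1 (s.setVar x (s.arr a (s.var i) (s.var j)))
  | store (s : State) (a i j x : ℕ) :
      Exec (.store a i j x) s 1 (s.setArr a (s.var i) (s.var j) (s.var x))
  | seq {p q : Prog} {s r w : State} {t₁ t₂ : ℕ} :
      Exec p s t₁ r → Exec q r t₂ w → Exec (.seq p q) s (t₁ + t₂) w
  | ite_pos {x : ℕ} {p q : Prog} {s r : State} {t : ℕ} :
      s.var x ≠ 0 → Exec p s t r → Exec (.ite x p q) s (1 + t) r
  | ite_neg {x : ℕ} {p q : Prog} {s r : State} {t : ℕ} :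
      s.var x = 0 → Exec q s t r → Exec (.ite x p q) s (1 + t) r
  | loop_done {x : ℕ} {p : Prog} {s : State} :
      s.var x = 0 → Exec (.loop x p) s 1 s
  | loop_step {x : ℕ} {p : Prog} {s r w : State} {t₁ t₂ : ℕ} :
      s.var x ≠ 0 → Exec p s t₁ r → Exec (.loop x p) r t₂ w →
        Exec (.loop x p) s (1 + t₁ + t₂) w

/-- The machine is deterministic: halting memory and number of steps are unique. -/
theorem Exec.det {p : Prog} {s r₁ r₂ : State} {t₁ t₂ : ℕ}
    (h₁ : Exec p s t₁ r₁) (h₂ : Exec p s t₂ r₂) : t₁ = t₂ ∧ r₁ = r₂ := by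
  induction h₁ generalizing t₂ r₂ with
  | seq _ _ ih₁ ih₂ =>
    cases h₂ with
    | seq a b =>
      obtain ⟨rfl, rfl⟩ := ih₁ a
      obtain ⟨rfl, rfl⟩ := ih₂ b
      exact ⟨rfl, rfl⟩
  | ite_pos hx _ ih =>
    cases h₂ with
    | ite_pos _ a => obtain ⟨rfl, rfl⟩ := ih a; exact ⟨rfl, rfl⟩
    | ite_neg hy _ => exact absurd hy hx
  | ite_neg hx _ ih =>
    cases h₂ with
    | ite_pos hy _ => exact absurd hx hy
    | ite_neg _ a => obtain ⟨rfl, rfl⟩ := ih a; exact ⟨rfl, rfl⟩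
  | loop_done hx =>
    cases h₂ with
    | loop_done _ => exact ⟨rfl, rfl⟩
    | loop_step hy _ _ => exact absurd hx hy
  | loop_step hx _ _ ih₁ ih₂ =>
    cases h₂ with
    | loop_done hy => exact absurd hy hx
    | loop_step _ a b =>
      obtain ⟨rfl, rfl⟩ := ih₁ a
      obtain ⟨rfl, rfl⟩ := ih₂ b
      exact ⟨rfl, rfl⟩
  | _ => cases h₂; exact ⟨rfl, rfl⟩

/-- The input memory for an election with voters `Fin n` and candidates `Fin m`: variables
`0`, `1`, `2` hold `n`, `m`, `k`, array `0` holds the approval matrix, all else is zero. -/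
def input {n m : ℕ} (E : Election (Fin n) (Fin m)) : State where
  var x := if x = 0 then n else if x = 1 then m else if x = 2 then E.k else 0
  arr a i j :=
    if a = 0 ∧ ∃ (hi : i < n) (hj : j < m), (⟨j, hj⟩ : Fin m) ∈ E.A ⟨i, hi⟩ then 1 else 0

/-- The committee written in row `0` of array `1`, as a characteristic vector. -/
def output (m : ℕ) (s : State) : Finset (Fin m) :=
  Finset.univ.filter (fun j => s.arr 1 0 (j : ℕ) ≠ 0)

/-- One program finds, for all elections whose profile lies in the domain `D`, a committee
satisfying `Good`, in a number of steps polynomial in the number of voters and candidates. -/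
def ComputableInPolyTime
    (D : ∀ {n m : ℕ}, (Fin n → Finset (Fin m)) → Prop)
    (Good : ∀ {n m : ℕ}, Election (Fin n) (Fin m) → Finset (Fin m) → Prop) : Prop :=
  ∃ (p : Prog) (T : Polynomial ℕ), ∀ (n m : ℕ) (E : Election (Fin n) (Fin m)), D E.A →
    ∃ (t : ℕ) (s : State), Exec p (input E) t s ∧ t ≤ T.eval (n + m) ∧ Good E (output m s)

end RAM

/-!
The algorithms never construct an ordering of the candidates; its mere existence makes a linear
relaxation exact, and the relaxation is solved by a method that uses additions and subtractions
only.

Give the candidates integer weights `X c` of total at most `k * N`, where `N` stands for one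
unit, and let each voter `v` count `min N (X(A_v))`. If every ballot is an interval of some
ordering of the candidates, then listing the candidates in order, each as often as its weight
says, and picking every `N`-th entry gives a committee of size `k`; averaged over the `N`
starting points it covers at least as many voters as the relaxation promises
(`exists_coverage_of_fracCoverage`). The rounding tolerates a small error in both constraints,
because coverage is an integer.

Whether the relaxation reaches a goal `s * N` is decided by subgradient descent
(`descentStep`): as long as a constraint is clearly violated, a step along its subgradient
strictly decreases the integer squared distance to every committee that reaches the goal, so
that such a committee forces the descent to settle within `k * N ^ 2` steps
(`isSettled_iterate_descentStep_iff`). The largest goal that can be reached is the optimum.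
Then candidates are struck off as long as the optimum can still be reached without them; in the
end the remaining candidates form an optimal committee, which is filled up to size `k`.

For the Pairs score in the VCI domain, the same procedure is applied to the profile of all pairs
of voters, restricted to the undominated candidates. Ordered by the left ends of their
intervals, these have convex ballots (`IsVCI.exists_convexBallots`), which passes to
intersections of ballots, and replacing a dominated candidate by one dominating it loses no
pair.

The programs are written in a language `RAM.Cmd` with counting loops only. Its commands denote
functions on memories (`RAM.Cmd.run`), which is what correctness is proved about, and the number
of steps is bounded by a polynomial read off the syntax (`RAM.Cmd.exec_compile`).
-/

/-! ### Ballots that are convex along an ordering of the candidates -/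

/-- Along the (weak) ordering of the candidates by `f`, every ballot is an interval of the
candidates in `S`. -/
def ConvexBallots {V C : Type*} (A : V → Finset C) (S : Set C) (f : C → ℝ) : Prop :=
  ∀ v, ∀ i ∈ S, ∀ j ∈ S, ∀ k ∈ S, i ∈ A v → k ∈ A v → f i ≤ f j → f j ≤ f k → j ∈ A v

theorem IsCI.exists_convexBallots {V C : Type*} {A : V → Finset C} (h : IsCI A) :
    ∃ f : C → ℝ, ConvexBallots A Set.univ f := by
  obtain ⟨m, σ, hσ⟩ := h
  refine ⟨fun c => ((σ c : ℕ) : ℝ), ?_⟩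
  intro v i _ j _ k _ hi hk hij hjk
  obtain ⟨a, b, hab⟩ := hσ v
  rw [hab] at hi hk ⊢
  have h1 : (σ i : ℕ) ≤ σ j := Nat.cast_le.1 hij
  have h2 : (σ j : ℕ) ≤ σ k := Nat.cast_le.1 hjk
  exact ⟨hi.1.trans h1, h2.trans hk.2⟩

theorem ConvexBallots.isCI {V C : Type*} [Fintype C] {A : V → Finset C} {f : C → ℝ}
    (h : ConvexBallots A Set.univ f) : IsCI A := by
  classical
  let e := Fintype.equivFin C
  let p := Tuple.sort (f ∘ e.symm)
  have hmono : Monotone ((f ∘ e.symm) ∘ p) := Tuple.monotone_sort _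
  let σ : C ≃ Fin (Fintype.card C) := e.trans p.symm
  have hf : ∀ c d, σ c ≤ σ d → f c ≤ f d := by
    intro c d hcd
    have := hmono hcd
    simpa [σ] using this
  refine ⟨Fintype.card C, σ, fun v => ?_⟩
  rcases (A v).eq_empty_or_nonempty with h0 | h0
  · refine ⟨1, 0, fun c => ?_⟩
    simp only [h0, Finset.notMem_empty, false_iff]
    omega
  · obtain ⟨i, hi, hmin⟩ := Finset.exists_min_image (A v) σ h0
    obtain ⟨k, hk, hmax⟩ := Finset.exists_max_image (A v) σ h0
    refine ⟨σ i, σ k, fun c => ⟨fun hc => ⟨hmin c hc, hmax c hc⟩, fun hc => ?_⟩⟩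
    exact h v i trivial c trivial k trivial hi hk (hf _ _ hc.1) (hf _ _ hc.2)

/-- Order the candidates by the left ends of their intervals. A candidate `j` that a voter
approving both its neighbours could miss only because its interval ends too early lies inside
the interval of the left neighbour, so that, not being dominated, it has the same supporters. -/
theorem IsVCI.exists_convexBallots {V C : Type*} {A : V → Finset C} (h : IsVCI A) :
    ∃ f : C → ℝ, ConvexBallots A {c | ¬ IsDominated A c} f := by
  obtain ⟨xV, rV, xC, rC, -, -, h⟩ := h
  have h' : ∀ v c, c ∈ A v ↔ xC c - rC c ≤ xV v + rV v ∧ xV v - rV v ≤ xC c + rC c := by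
    intro v c
    rw [h, abs_le]
    constructor <;> rintro ⟨h1, h2⟩ <;> constructor <;> linarith
  refine ⟨fun c => xC c - rC c, ?_⟩
  intro v i _ j hj k _ hi hk hij hjk
  rcases le_or_gt (xC i + rC i) (xC j + rC j) with hu | hu
  · rw [h'] at hi hk ⊢
    exact ⟨hjk.trans hk.1, hi.2.trans hu⟩
  · have hsub : supporters A j ⊆ supporters A i := by
      intro w hw
      simp only [supporters, Set.mem_ofPred_eq, h'] at hw ⊢
      exact ⟨hij.trans hw.1, hw.2.trans hu.le⟩
    by_contra hv
    exact hj ⟨i, hsub, fun hle => hv (hle (show v ∈ supporters A i from hi))⟩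

theorem IsVCI.isCI_removeDominated {V C : Type*} [Fintype C] {A : V → Finset C}
    (h : IsVCI A) : IsCI (removeDominated A) := by
  classical
  obtain ⟨f, hf⟩ := h.exists_convexBallots
  have : ConvexBallots (removeDominated A) Set.univ (fun c => f c.1) := by
    intro v i _ j _ k _ hi hk hij hjk
    simp only [removeDominated, Finset.mem_subtype] at hi hk ⊢
    exact hf v i i.2 j j.2 k k.2 hi hk hij hjk
  convert this.isCI

theorem exists_not_isDominated_supporters_subset {V C : Type*} [Finite C]
    (A : V → Finset C) (d : C) :
    ∃ c, ¬ IsDominated A c ∧ supporters A d ⊆ supporters A c := by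
  obtain ⟨c, hc, hmax⟩ := Set.Finite.exists_maximalFor (supporters A)
    {c | supporters A d ⊆ supporters A c} (Set.toFinite _) ⟨d, subset_refl (supporters A d)⟩
  refine ⟨c, ?_, hc⟩
  rintro ⟨e, he⟩
  exact he.2 (hmax (j := e) (hc.trans he.1) he.1)

namespace Election

theorem isCI_pairInstance {V C : Type*} [Fintype C] [DecidableEq C] (E : Election V C)
    (h : IsCI E.A) : IsCI E.pairInstance.A := by
  obtain ⟨f, hf⟩ := h.exists_convexBallots
  refine ConvexBallots.isCI (f := f) ?_
  intro p i hi j hj k hk hip hkp hij hjk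
  simp only [pairInstance, Finset.mem_filter, Finset.mem_univ, true_and] at hip hkp ⊢
  exact fun v hv => hf v i hi j hj k hk (hip v hv) (hkp v hv) hij hjk

theorem pairs_eq_cc_pairInstance {V C : Type*} [Fintype V] [Fintype C] [DecidableEq V]
    [DecidableEq C] (E : Election V C) (W : Finset C) : E.pairs W = E.pairInstance.cc W := by
  unfold pairs cc
  symm
  refine Finset.card_bij (fun p _ => p.1) ?_ ?_ ?_
  · rintro ⟨p, hp⟩ h
    obtain ⟨u, v, huv, rfl⟩ := Finset.card_eq_two.1 hp
    simp only [Finset.mem_filter, Finset.mem_univ, true_and, Finset.mem_powersetCard,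
      Finset.subset_univ] at h ⊢
    refine ⟨hp, u, v, rfl, ?_⟩
    obtain ⟨c, hc⟩ := h
    refine ⟨c, ?_⟩
    simpa [pairInstance, and_assoc] using hc
  · rintro ⟨p, hp⟩ _ ⟨q, hq⟩ _ h
    exact Subtype.ext h
  · intro p hp
    simp only [Finset.mem_filter, Finset.mem_powersetCard, Finset.subset_univ,
      true_and] at hp
    obtain ⟨hp, u, v, rfl, c, hc⟩ := hp
    refine ⟨⟨{u, v}, hp⟩, ?_, rfl⟩
    simp only [Finset.mem_filter, Finset.mem_univ, true_and]
    refine ⟨c, ?_⟩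
    simpa [pairInstance, and_assoc] using hc

end Election

/-! ### Rounding fractional committees -/

section Rounding

variable {V C : Type*} [Fintype V] [Fintype C] [DecidableEq C]

/-- The number of ballots of `A` that meet `W`. -/
def coverage {V C : Type*} [Fintype V] [DecidableEq C] (A : V → Finset C) (W : Finset C) : ℕ :=
  (Finset.univ.filter (fun v => (A v ∩ W).Nonempty)).card

theorem coverage_mono {V C : Type*} [Fintype V] [DecidableEq C] (A : V → Finset C) {U W : Finset C} (h : U ⊆ W) :
    coverage A U ≤ coverage A W := by
  refine Finset.card_le_card fun v hv => ?_
  simp only [Finset.mem_filter, Finset.mem_univ, true_and] at hv ⊢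
  exact hv.mono (Finset.inter_subset_inter_left h)

/-- The total weight, truncated at `N` for each voter, that a weighting `X` of the candidates
gives to the ballots. With `N` as the unit of weight, this is the objective of the linear
relaxation of the Chamberlin-Courant problem. -/
def fracCoverage {V C : Type*} [Fintype V] (A : V → Finset C) (N : ℕ) (X : C → ℕ) : ℕ :=
  ∑ v, min N (∑ c ∈ A v, X c)

/-- A weighting of the candidates can be listed as a sequence of candidates sorted by `f`, each
occurring as often as its weight says. -/
theorem exists_sorted_list (f : C → ℝ) (X : C → ℕ) :
    ∃ L : List C, L.Pairwise (fun a b => f a ≤ f b) ∧ ∀ c, L.count c = X c := by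
  let r : C → C → Prop := fun a b => f a ≤ f b
  have : Std.Total r := ⟨fun a b => le_total (f a) (f b)⟩
  have : IsTrans C r := ⟨fun a b c h1 h2 => le_trans (α := ℝ) h1 h2⟩
  classical
  let M : Multiset C := ∑ c, Multiset.replicate (X c) c
  refine ⟨M.toList.insertionSort r, List.pairwise_insertionSort r _, fun c => ?_⟩
  rw [(List.perm_insertionSort r _).count_eq, ← Multiset.coe_count, Multiset.coe_toList]
  simp [M, Multiset.count_sum', Multiset.count_replicate]

theorem card_filter_getElem?_eq_some {C : Type*} [DecidableEq C] (l : List C) (c : C) :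
    ((Finset.range l.length).filter (fun t => l[t]? = some c)).card = l.count c := by
  induction l with
  | nil => simp
  | cons a l ih =>
    rw [List.length_cons, Finset.range_add_one', Finset.filter_insert, Finset.filter_map]
    simp only [List.getElem?_cons_zero, List.count_cons, Option.some.injEq, beq_iff_eq]
    split_ifs with hac
    · rw [Finset.card_insert_of_notMem (by simp), Finset.card_map, ← ih]
      rfl
    · rw [Finset.card_map, ← ih]
      rfl

/-- A set of consecutive natural numbers meets at least `min N` of its size many residue
classes modulo `N`. -/
theorem min_card_le_card_residues (N : ℕ) (M : Finset ℕ)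
    (hM : ∀ a ∈ M, ∀ b ∈ M, ∀ t, a ≤ t → t ≤ b → t ∈ M) :
    min N M.card ≤ ((Finset.range N).filter (fun θ => ∃ t ∈ M, t % N = θ)).card := by
  rcases M.eq_empty_or_nonempty with rfl | hne
  · simp
  rcases Nat.eq_zero_or_pos N with rfl | hN
  · simp
  set a := M.min' hne
  set b := M.max' hne
  have hMeq : M = Finset.Icc a b := by
    ext t
    rw [Finset.mem_Icc]
    exact ⟨fun h => ⟨M.min'_le _ h, M.le_max' _ h⟩,
      fun h => hM a (M.min'_mem _) b (M.max'_mem _) t h.1 h.2⟩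
  set q := min N M.card
  have hsub : ∀ t ∈ Finset.Ico a (a + q), t ∈ M := by
    intro t ht
    have hc : M.card = b + 1 - a := by rw [hMeq, Nat.card_Icc]
    have hq : q ≤ M.card := min_le_right _ _
    rw [Finset.mem_Ico] at ht
    rw [hMeq, Finset.mem_Icc]
    omega
  have hinj : Set.InjOn (fun t => t % N) (Finset.Ico a (a + q) : Set ℕ) := by
    intro s hs t ht hst
    simp only [Finset.coe_Ico, Set.mem_Ico] at hs ht
    have hqN : q ≤ N := min_le_left _ _
    have h1 := Nat.div_add_mod s N
    have h2 := Nat.div_add_mod t N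
    simp only at hst
    rcases lt_trichotomy (s / N) (t / N) with h | h | h
    · have := Nat.mul_le_mul_left N (Nat.succ_le_of_lt h)
      rw [Nat.mul_succ] at this
      omega
    · rw [h] at h1
      omega
    · have := Nat.mul_le_mul_left N (Nat.succ_le_of_lt h)
      rw [Nat.mul_succ] at this
      omega
  calc q = (Finset.Ico a (a + q)).card := by simp
    _ = ((Finset.Ico a (a + q)).image (fun t => t % N)).card :=
        (Finset.card_image_of_injOn hinj).symm
    _ ≤ _ := by
        refine Finset.card_le_card fun θ hθ => ?_
        obtain ⟨t, ht, rfl⟩ := Finset.mem_image.1 hθ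
        simp only [Finset.mem_filter, Finset.mem_range]
        exact ⟨Nat.mod_lt _ hN, t, hsub t ht, rfl⟩

/-- Threshold rounding. List the candidates in order, each as often as its weight `X` says, and
take the entries at the positions congruent to `θ` modulo `N`. A ballot is an interval, so its
entries are consecutive and it is met for at least `min N (X(A_v))` of the `N` choices of `θ`.
For `θ ≥ B` at most `k` entries are taken, so the best such `θ` gives the committee. -/
theorem exists_coverage_of_fracCoverage {A : V → Finset C} {S : Finset C} {f : C → ℝ}
    (hconv : ConvexBallots A S f) {X : C → ℕ} (hX : ∀ c, X c ≠ 0 → c ∈ S) {N k B R s : ℕ}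
    (hsum : ∑ c, X c < k * N + B) (hF : s * N < fracCoverage A N X + R)
    (hN : R + B * Fintype.card V ≤ N) :
    ∃ W ⊆ S, W.card ≤ k ∧ s ≤ coverage A W := by
  classical
  obtain ⟨L, hsort, hcount⟩ := exists_sorted_list f X
  have hmemS : ∀ c ∈ L, c ∈ S := fun c hc => hX c (by
    rw [← hcount]; exact (List.count_pos_iff.2 hc).ne')
  have hlen : L.length = ∑ c, X c := by
    rw [← Finset.sum_congr rfl (fun c _ => hcount c)]
    rw [← List.sum_toFinset_count_eq_length L]
    refine Finset.sum_subset (Finset.subset_univ _) fun c _ hc => ?_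
    rw [List.count_eq_zero]
    simpa using hc
  -- the positions of the list that hold a candidate approved by `v`
  let M : V → Finset ℕ := fun v =>
    (Finset.range L.length).filter (fun t => ∃ c ∈ A v, L[t]? = some c)
  have hMconv : ∀ v, ∀ a ∈ M v, ∀ b ∈ M v, ∀ t, a ≤ t → t ≤ b → t ∈ M v := by
    intro v a ha b hb t hat htb
    simp only [M, Finset.mem_filter, Finset.mem_range] at ha hb ⊢
    obtain ⟨ha, i, hi, hai⟩ := ha
    obtain ⟨hb, k, hk, hbk⟩ := hb
    have ht : t < L.length := by omega
    refine ⟨ht, L[t], ?_, List.getElem?_eq_getElem ht⟩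
    rw [List.getElem?_eq_getElem ha, Option.some.injEq] at hai
    rw [List.getElem?_eq_getElem hb, Option.some.injEq] at hbk
    have hle : ∀ p q (hp : p < L.length) (hq : q < L.length), p ≤ q → f L[p] ≤ f L[q] := by
      intro p q hp hq hpq
      rcases hpq.eq_or_lt with rfl | h
      · exact le_rfl
      · exact List.pairwise_iff_getElem.1 hsort p q hp hq h
    refine hconv v i (hai ▸ hmemS _ (List.getElem_mem _)) _ (hmemS _ (List.getElem_mem _)) k
      (hbk ▸ hmemS _ (List.getElem_mem _)) hi hk ?_ ?_
    · rw [← hai]; exact hle _ _ _ _ hat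
    · rw [← hbk]; exact hle _ _ _ _ htb
  have hMcard : ∀ v, (M v).card = ∑ c ∈ A v, X c := by
    intro v
    have h1 : M v = (A v).biUnion (fun c =>
        (Finset.range L.length).filter (fun t => L[t]? = some c)) := by
      ext t
      simp only [M, Finset.mem_filter, Finset.mem_biUnion]
      tauto
    rw [h1, Finset.card_biUnion]
    · refine Finset.sum_congr rfl fun c _ => ?_
      rw [← hcount c]
      exact card_filter_getElem?_eq_some L c
    · intro c _ d _ hcd
      refine Finset.disjoint_left.2 fun t hc hd => hcd ?_
      rw [Finset.mem_filter] at hc hd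
      exact Option.some.inj (hc.2.symm.trans hd.2)
  let W : ℕ → Finset C := fun θ =>
    Finset.univ.filter (fun c => ∃ j < k, L[θ + N * j]? = some c)
  have hWcard : ∀ θ, (W θ).card ≤ k := by
    intro θ
    have : (W θ).image some ⊆ (Finset.range k).image (fun j => L[θ + N * j]?) := by
      intro o ho
      obtain ⟨c, hc, rfl⟩ := Finset.mem_image.1 ho
      simp only [W, Finset.mem_filter, Finset.mem_univ, true_and] at hc
      obtain ⟨j, hj, hc⟩ := hc
      exact Finset.mem_image.2 ⟨j, Finset.mem_range.2 hj, hc⟩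
    calc (W θ).card = ((W θ).image some).card :=
          (Finset.card_image_of_injective _ (Option.some_injective _)).symm
      _ ≤ _ := Finset.card_le_card this
      _ ≤ _ := Finset.card_image_le
      _ = k := Finset.card_range k
  have hWS : ∀ θ, W θ ⊆ S := by
    intro θ c hc
    simp only [W, Finset.mem_filter, Finset.mem_univ, true_and] at hc
    obtain ⟨j, -, hc⟩ := hc
    exact hmemS c (List.mem_of_getElem? hc)
  have hcov : ∀ v, min N (∑ c ∈ A v, X c) ≤
      ((Finset.range N).filter (fun θ => B ≤ θ ∧ (A v ∩ W θ).Nonempty)).card + B := by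
    intro v
    rw [← hMcard]
    refine (min_card_le_card_residues N (M v) (hMconv v)).trans ?_
    calc _ ≤ (((Finset.range N).filter (fun θ => B ≤ θ ∧ (A v ∩ W θ).Nonempty)) ∪
          Finset.range B).card := by
          refine Finset.card_le_card fun θ hθ => ?_
          simp only [Finset.mem_filter, Finset.mem_range, Finset.mem_union] at hθ ⊢
          obtain ⟨hθN, t, ht, rfl⟩ := hθ
          rcases lt_or_ge (t % N) B with h | h
          · exact Or.inr h
          refine Or.inl ⟨hθN, h, ?_⟩
          simp only [M, Finset.mem_filter, Finset.mem_range] at ht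
          obtain ⟨htL, c, hc, htc⟩ := ht
          refine ⟨c, ?_⟩
          simp only [W, Finset.mem_inter, Finset.mem_filter, Finset.mem_univ, true_and]
          refine ⟨hc, t / N, ?_, by rw [Nat.mod_add_div]; exact htc⟩
          have h1 := Nat.mod_add_div t N
          have h2 : N * (t / N) < N * k := by rw [Nat.mul_comm N k]; omega
          exact lt_of_mul_lt_mul_left h2 (Nat.zero_le _)
      _ ≤ _ := (Finset.card_union_le _ _).trans (by simp)
  by_contra! hno
  have hlt : ∀ θ, coverage A (W θ) + 1 ≤ s := fun θ => hno (W θ) (hWS θ) (hWcard θ)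
  have hs : 1 ≤ s := (Nat.le_add_left _ _).trans (hlt 0)
  have key : fracCoverage A N X ≤ (s - 1) * N + B * Fintype.card V := by
    calc fracCoverage A N X
        ≤ ∑ v, (((Finset.range N).filter
            (fun θ => B ≤ θ ∧ (A v ∩ W θ).Nonempty)).card + B) :=
          Finset.sum_le_sum fun v _ => hcov v
      _ ≤ ∑ v, ((Finset.range N).filter (fun θ => (A v ∩ W θ).Nonempty)).card +
            B * Fintype.card V := by
          rw [Finset.sum_add_distrib]
          refine add_le_add (Finset.sum_le_sum fun v _ => ?_) ?_
          · refine Finset.card_le_card fun θ => ?_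
            simp only [Finset.mem_filter]
            tauto
          · simp [mul_comm]
      _ = ∑ θ ∈ Finset.range N, coverage A (W θ) + B * Fintype.card V := by
          simp only [coverage, Finset.card_filter]
          rw [Finset.sum_comm]
      _ ≤ _ := by
          refine Nat.add_le_add_right ?_ _
          refine (Finset.sum_le_card_nsmul _ _ (s - 1) fun θ _ => ?_).trans ?_
          · have := hlt θ; omega
          · simp [mul_comm]
  obtain ⟨s, rfl⟩ : ∃ t, s = t + 1 := ⟨s - 1, by omega⟩
  simp only [Nat.add_sub_cancel, Nat.add_mul] at key hF
  omega

end Rounding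

/-! ### Subgradient descent on the linear relaxation -/

section Descent

variable {V C : Type*} [Fintype V] [Fintype C] [DecidableEq C]

/-- The weighting `X` almost satisfies the constraints of the relaxation: the total weight is at
most `lim`, and the objective misses the goal `Q` by less than `R`. -/
def IsSettled (A : V → Finset C) (N lim R Q : ℕ) (X : C → ℕ) : Prop :=
  ∑ c, X c ≤ lim ∧ Q < fracCoverage A N X + R

open Classical in
/-- One step of the descent: if the total weight is too large, decrease all weights; if the
objective is too small, add its subgradient, restricted to the candidates in `S`; otherwise
stay. -/
noncomputable def descentStep (A : V → Finset C) (S : Finset C) (N lim R Q : ℕ) (X : C → ℕ) :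
    C → ℕ :=
  if lim < ∑ c, X c then fun c => X c - 1
  else if Q < fracCoverage A N X + R then X
  else fun c => X c +
    if c ∈ S then (Finset.univ.filter (fun v => ∑ d ∈ A v, X d < N ∧ c ∈ A v)).card else 0

/-- The squared distance of the weighting `X` from the committee `W` in units of weight `N`. -/
def sqDist (N : ℕ) (W : Finset C) (X : C → ℕ) : ℤ :=
  ∑ c, ((X c : ℤ) - if c ∈ W then (N : ℤ) else 0) ^ 2

variable {A : V → Finset C} {S : Finset C} {N lim R Q : ℕ}

theorem descentStep_eq_self {X : C → ℕ} (h : IsSettled A N lim R Q X) :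
    descentStep A S N lim R Q X = X := by
  rw [descentStep, if_neg (not_lt.2 h.1), if_pos h.2]

theorem descentStep_support {X : C → ℕ} (hX : ∀ c, X c ≠ 0 → c ∈ S) :
    ∀ c, descentStep A S N lim R Q X c ≠ 0 → c ∈ S := by
  intro c hc
  by_contra hcS
  have h0 : X c = 0 := by
    by_contra h
    exact hcS (hX c h)
  apply hc
  unfold descentStep
  split_ifs <;> simp [h0, hcS]

theorem descentStep_iterate_support (t : ℕ) :
    ∀ c, (descentStep A S N lim R Q)^[t] 0 c ≠ 0 → c ∈ S := by
  induction t with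
  | zero => intro c hc; simp at hc
  | succ t ih =>
    rw [Function.iterate_succ_apply']
    exact descentStep_support ih

theorem sqDist_sub_one_lt {X : C → ℕ} {W : Finset C} {k B : ℕ} (hW : W.card ≤ k)
    (hC : Fintype.card C < 2 * B) (h : k * N + B ≤ ∑ c, X c) :
    sqDist N W (fun c => X c - 1) < sqDist N W X := by
  have h1 : ∀ c, (((X c - 1 : ℕ) : ℤ) - if c ∈ W then (N : ℤ) else 0) ^ 2 ≤
      ((X c : ℤ) - if c ∈ W then (N : ℤ) else 0) ^ 2
        + (1 - 2 * (X c - if c ∈ W then (N : ℤ) else 0)) := by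
    intro c
    have hx : (0 : ℤ) ≤ if c ∈ W then (N : ℤ) else 0 := by split_ifs <;> positivity
    generalize (if c ∈ W then (N : ℤ) else 0) = x at hx
    rcases Nat.eq_zero_or_pos (X c) with h0 | h0
    · rw [h0]; push_cast; nlinarith
    · rw [Nat.cast_sub h0]; push_cast; nlinarith
  have h2 : (∑ c, (X c : ℤ)) ≥ k * N + B := by exact_mod_cast h
  have h3 : (∑ c, if c ∈ W then (N : ℤ) else 0) ≤ k * N := by
    rw [← Finset.sum_filter]
    simp only [Finset.sum_const, nsmul_eq_mul, Finset.filter_univ_mem]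
    gcongr
  have h4 : (Fintype.card C : ℤ) < 2 * B := by exact_mod_cast hC
  calc sqDist N W (fun c => X c - 1) ≤ _ := Finset.sum_le_sum fun c _ => h1 c
    _ = sqDist N W X + (Fintype.card C - 2 * (∑ c, (X c : ℤ) -
          ∑ c, if c ∈ W then (N : ℤ) else 0)) := by
        rw [Finset.sum_add_distrib, Finset.sum_sub_distrib, ← Finset.mul_sum,
          Finset.sum_sub_distrib]
        simp [sqDist]
    _ < _ := by linarith

/-- Adding the subgradient brings the weighting closer to every committee that reaches the
goal: the objective is concave, so the inner product of the subgradient with the direction to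
the committee is at least the gap in the objective, and this outweighs the quadratic term. -/
theorem sqDist_add_subgradient_lt {X : C → ℕ} (hX : ∀ c, X c ≠ 0 → c ∈ S) {W : Finset C}
    (hWS : W ⊆ S) (hR : Fintype.card C * Fintype.card V ^ 2 ≤ R) (hR0 : 0 < R)
    (hQ : Q ≤ coverage A W * N) (h : fracCoverage A N X + R ≤ Q) :
    sqDist N W (fun c => X c + if c ∈ S then
      (Finset.univ.filter (fun v => ∑ d ∈ A v, X d < N ∧ c ∈ A v)).card else 0) <
      sqDist N W X := by
  classical
  set g : C → ℕ := fun c => if c ∈ S then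
      (Finset.univ.filter (fun v => ∑ d ∈ A v, X d < N ∧ c ∈ A v)).card else 0 with hg
  set x : C → ℤ := fun c => if c ∈ W then (N : ℤ) else 0 with hx
  have hsq : (∑ c, (g c : ℤ) ^ 2) ≤ R := by
    have h1 : ∀ c, g c ≤ Fintype.card V := by
      intro c
      simp only [hg]
      split_ifs
      · exact Finset.card_le_univ _
      · exact Nat.zero_le _
    have : ∑ c, (g c) ^ 2 ≤ R := by
      refine (Finset.sum_le_card_nsmul _ _ (Fintype.card V ^ 2) fun c _ => ?_).trans ?_
      · exact Nat.pow_le_pow_left (h1 c) 2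
      · simpa using hR
    exact_mod_cast this
  have hinner : (R : ℤ) ≤ ∑ c, (g c : ℤ) * (x c - X c) := by
    have h1 : ∀ c, (g c : ℤ) * (x c - X c) =
        ∑ v, if ∑ d ∈ A v, X d < N ∧ c ∈ A v then x c - X c else 0 := by
      intro c
      rw [← Finset.sum_filter, Finset.sum_const, nsmul_eq_mul]
      by_cases hc : c ∈ S
      · simp [hg, hc]
      · have h0 : X c = 0 := by
          by_contra h
          exact hc (hX c h)
        have : c ∉ W := fun h => hc (hWS h)
        simp [hx, h0, this]
    have h2 : ∀ v, (if (A v ∩ W).Nonempty then (N : ℤ) else 0) -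
        ((min N (∑ d ∈ A v, X d) : ℕ) : ℤ) ≤
        ∑ c, if ∑ d ∈ A v, X d < N ∧ c ∈ A v then x c - X c else 0 := by
      intro v
      by_cases hv : ∑ d ∈ A v, X d < N
      · simp only [hv, true_and]
        rw [← Finset.sum_filter, Finset.filter_univ_mem, Finset.sum_sub_distrib,
          min_eq_right hv.le]
        push_cast
        refine sub_le_sub_right ?_ _
        rw [hx, ← Finset.sum_filter, Finset.filter_mem_eq_inter, Finset.sum_const,
          nsmul_eq_mul]
        split_ifs with hne
        · have : (1 : ℤ) ≤ (A v ∩ W).card := by exact_mod_cast hne.card_pos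
          nlinarith
        · positivity
      · simp only [hv, false_and, if_false, Finset.sum_const_zero]
        rw [min_eq_left (not_lt.1 hv)]
        split_ifs <;> simp
    simp only [h1]
    rw [Finset.sum_comm]
    refine le_trans ?_ (Finset.sum_le_sum fun v _ => h2 v)
    rw [Finset.sum_sub_distrib, ← Finset.sum_filter, Finset.sum_const, nsmul_eq_mul]
    have h3 : ((fracCoverage A N X + R : ℕ) : ℤ) ≤ ((coverage A W * N : ℕ) : ℤ) := by
      exact_mod_cast h.trans hQ
    simp only [fracCoverage, coverage] at h3
    push_cast at h3 ⊢
    linarith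
  have hexp : sqDist N W (fun c => X c + g c) = sqDist N W X
      - 2 * (∑ c, (g c : ℤ) * (x c - X c)) + ∑ c, (g c : ℤ) ^ 2 := by
    simp only [sqDist, Finset.mul_sum]
    rw [← Finset.sum_sub_distrib, ← Finset.sum_add_distrib]
    refine Finset.sum_congr rfl fun c _ => ?_
    simp only [hx]
    push_cast
    ring
  rw [hexp]
  have : (0 : ℤ) < R := by exact_mod_cast hR0
  linarith

theorem sqDist_nonneg (N : ℕ) (W : Finset C) (X : C → ℕ) : 0 ≤ sqDist N W X :=
  Finset.sum_nonneg fun _ _ => sq_nonneg _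

theorem sqDist_zero (N : ℕ) (W : Finset C) : sqDist N W 0 = W.card * (N : ℤ) ^ 2 := by
  simp [sqDist, ite_pow]

/-- The descent decides whether a committee of size `k` inside `S` can cover `s` ballots. -/
theorem isSettled_iterate_descentStep_iff {f : C → ℝ} (hconv : ConvexBallots A S f)
    {k B s T : ℕ} (hlim : lim + 1 = k * N + B) (hC : Fintype.card C < 2 * B)
    (hR : Fintype.card C * Fintype.card V ^ 2 ≤ R) (hR0 : 0 < R)
    (hN : R + B * Fintype.card V ≤ N) (hT : k * N ^ 2 < T) :
    IsSettled A N lim R (s * N) ((descentStep A S N lim R (s * N))^[T] 0) ↔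
      ∃ W ⊆ S, W.card ≤ k ∧ s ≤ coverage A W := by
  constructor
  · rintro ⟨h1, h2⟩
    exact exists_coverage_of_fracCoverage hconv (descentStep_iterate_support T)
      (by omega) h2 hN
  · rintro ⟨W, hWS, hWk, hWs⟩
    have hmain : ∀ t, IsSettled A N lim R (s * N) ((descentStep A S N lim R (s * N))^[t] 0) ∨
        sqDist N W ((descentStep A S N lim R (s * N))^[t] 0) + t ≤ sqDist N W 0 := by
      intro t
      induction t with
      | zero => simp
      | succ t ih =>
        rw [Function.iterate_succ_apply']
        set X := (descentStep A S N lim R (s * N))^[t] 0 with hXdef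
        have hX : ∀ c, X c ≠ 0 → c ∈ S := descentStep_iterate_support t
        by_cases hset : IsSettled A N lim R (s * N) X
        · left
          rwa [descentStep_eq_self hset]
        right
        replace ih := ih.resolve_left hset
        have hdec : sqDist N W (descentStep A S N lim R (s * N) X) < sqDist N W X := by
          unfold descentStep
          split_ifs with h1 h2
          · exact sqDist_sub_one_lt hWk hC (by omega)
          · exact absurd ⟨not_lt.1 h1, h2⟩ hset
          · convert sqDist_add_subgradient_lt hX hWS hR hR0 (Nat.mul_le_mul_right N hWs)
              (not_lt.1 h2)
        push_cast
        linarith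
    rcases hmain T with h | h
    · exact h
    -- otherwise all the steps were proper, and the distance from `W` has become negative
    · rw [sqDist_zero] at h
      have h0 := sqDist_nonneg N W ((descentStep A S N lim R (s * N))^[T] 0)
      have h1 : (W.card : ℤ) * (N : ℤ) ^ 2 < T := by
        exact_mod_cast (Nat.mul_le_mul_right _ hWk).trans_lt hT
      linarith

end Descent

/-! ### Programs with counting loops only -/

namespace RAM

@[simp] theorem State.setVar_var (s : State) (x val y : ℕ) :
    (s.setVar x val).var y = if y = x then val else s.var y := rfl

@[simp] theorem State.setVar_arr (s : State) (x val : ℕ) : (s.setVar x val).arr = s.arr := rfl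

@[simp] theorem State.setArr_var (s : State) (a i j val : ℕ) :
    (s.setArr a i j val).var = s.var := rfl

@[simp] theorem State.setArr_arr (s : State) (a i j val b p q : ℕ) :
    (s.setArr a i j val).arr b p q = if b = a ∧ p = i ∧ q = j then val else s.arr b p q := rfl

/-- Programs whose only loops are counting loops. They always halt, so that they denote a
function on memories. Variable `3` is reserved for the loop tests. -/
inductive Cmd where
  | skip : Cmd
  | const (x c : ℕ) : Cmd
  | add (x y z : ℕ) : Cmd
  | sub (x y z : ℕ) : Cmd
  | load (x a i j : ℕ) : Cmd
  | store (a i j x : ℕ) : Cmd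
  | seq (p q : Cmd) : Cmd
  | ite (x : ℕ) (p q : Cmd) : Cmd
  /-- for `i` from `0` to `b - 1` do `p` -/
  | forLoop (i b : ℕ) (p : Cmd) : Cmd

namespace Cmd

infixr:30 " ;; " => Cmd.seq

/-- The machine program for a command. -/
def compile : Cmd → Prog
  | skip => .skip
  | const x c => .const x c
  | add x y z => .add x y z
  | sub x y z => .sub x y z
  | load x a i j => .load x a i j
  | store a i j x => .store a i j x
  | seq p q => .seq p.compile q.compile
  | ite x p q => .ite x p.compile q.compile
  | .forLoop i b p => .seq (.const i 0) (.seq (.sub 3 b i) (.loop 3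
      (.seq p.compile (.seq (.const 3 1) (.seq (.add i i 3) (.sub 3 b i))))))

/-- The bookkeeping at the end of a pass through a counting loop. -/
def tick (i b : ℕ) (r : State) : State :=
  (r.setVar i (r.var i + 1)).setVar 3 (r.var b - (r.var i + 1))

theorem tick_var (i b : ℕ) (r : State) (y : ℕ) :
    (tick i b r).var y =
      if y = 3 then r.var b - (r.var i + 1) else if y = i then r.var i + 1 else r.var y := rfl

@[simp] theorem tick_arr (i b : ℕ) (r : State) : (tick i b r).arr = r.arr := rfl

/-- The memory in which a command halts. -/
def run : Cmd → State → State
  | skip, s => s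
  | const x c, s => s.setVar x c
  | add x y z, s => s.setVar x (s.var y + s.var z)
  | sub x y z, s => s.setVar x (s.var y - s.var z)
  | load x a i j, s => s.setVar x (s.arr a (s.var i) (s.var j))
  | store a i j x, s => s.setArr a (s.var i) (s.var j) (s.var x)
  | seq p q, s => q.run (p.run s)
  | ite x p q, s => if s.var x ≠ 0 then p.run s else q.run s
  | .forLoop i b p, s =>
      (fun r => tick i b (p.run r))^[s.var b] ((s.setVar i 0).setVar 3 (s.var b))

@[simp] theorem run_skip (s : State) : run .skip s = s := rfl
@[simp] theorem run_const (x c : ℕ) (s : State) : run (.const x c) s = s.setVar x c := rfl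
@[simp] theorem run_add (x y z : ℕ) (s : State) :
    run (.add x y z) s = s.setVar x (s.var y + s.var z) := rfl
@[simp] theorem run_sub (x y z : ℕ) (s : State) :
    run (.sub x y z) s = s.setVar x (s.var y - s.var z) := rfl
@[simp] theorem run_load (x a i j : ℕ) (s : State) :
    run (.load x a i j) s = s.setVar x (s.arr a (s.var i) (s.var j)) := rfl
@[simp] theorem run_store (a i j x : ℕ) (s : State) :
    run (.store a i j x) s = s.setArr a (s.var i) (s.var j) (s.var x) := rfl
@[simp] theorem run_seq (p q : Cmd) (s : State) : run (p ;; q) s = q.run (p.run s) := rfl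
theorem run_ite (x : ℕ) (p q : Cmd) (s : State) :
    run (.ite x p q) s = if s.var x ≠ 0 then p.run s else q.run s := rfl

/-- The variables that a command may change. -/
def varsWritten : Cmd → List ℕ
  | skip => []
  | const x _ => [x]
  | add x _ _ => [x]
  | sub x _ _ => [x]
  | load x _ _ _ => [x]
  | store _ _ _ _ => []
  | seq p q => p.varsWritten ++ q.varsWritten
  | ite _ p q => p.varsWritten ++ q.varsWritten
  | .forLoop i _ p => 3 :: i :: p.varsWritten

/-- The arrays that a command may change. -/
def arrsWritten : Cmd → List ℕ
  | skip => []
  | const _ _ => []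
  | add _ _ _ => []
  | sub _ _ _ => []
  | load _ _ _ _ => []
  | store a _ _ _ => [a]
  | seq p q => p.arrsWritten ++ q.arrsWritten
  | ite _ p q => p.arrsWritten ++ q.arrsWritten
  | .forLoop _ _ p => p.arrsWritten

theorem run_var_of_notMem (p : Cmd) {x : ℕ} (hx : x ∉ p.varsWritten) (s : State) :
    (p.run s).var x = s.var x := by
  induction p generalizing s with
  | seq p q ihp ihq =>
    simp only [varsWritten, List.mem_append, not_or] at hx
    rw [run_seq, ihq hx.2, ihp hx.1]
  | ite y p q ihp ihq =>
    simp only [varsWritten, List.mem_append, not_or] at hx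
    rw [run_ite]
    split_ifs
    · exact ihp hx.1 s
    · exact ihq hx.2 s
  | forLoop i b p ih =>
    simp only [varsWritten, List.mem_cons, not_or] at hx
    rw [run]
    have : ∀ (n : ℕ) (r : State), ((fun r => tick i b (p.run r))^[n] r).var x = r.var x := by
      intro n
      induction n with
      | zero => intro r; rfl
      | succ n ihn =>
        intro r
        rw [Function.iterate_succ_apply, ihn]
        simp [tick, hx.1, hx.2.1, ih hx.2.2]
    rw [this]
    simp [hx.1, hx.2.1]
  | _ => simp_all [varsWritten]

theorem run_arr_of_notMem (p : Cmd) {a : ℕ} (ha : a ∉ p.arrsWritten) (s : State) :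
    (p.run s).arr a = s.arr a := by
  induction p generalizing s with
  | seq p q ihp ihq =>
    simp only [arrsWritten, List.mem_append, not_or] at ha
    rw [run_seq, ihq ha.2, ihp ha.1]
  | ite y p q ihp ihq =>
    simp only [arrsWritten, List.mem_append, not_or] at ha
    rw [run_ite]
    split_ifs
    · exact ihp ha.1 s
    · exact ihq ha.2 s
  | forLoop i b p ih =>
    rw [run]
    have : ∀ (n : ℕ) (r : State), ((fun r => tick i b (p.run r))^[n] r).arr a = r.arr a := by
      intro n
      induction n with
      | zero => intro r; rfl
      | succ n ihn =>
        intro r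
        rw [Function.iterate_succ_apply, ihn]
        simp [tick, ih ha]
    rw [this]
    simp
  | store b i j x =>
    funext p q
    simp only [arrsWritten, List.mem_singleton] at ha
    simp [ha]
  | _ => simp_all

/-- Loop counters are changed by the loop itself only, and loop bounds not at all. -/
def LoopsOK : Cmd → Prop
  | seq p q => p.LoopsOK ∧ q.LoopsOK
  | ite _ p q => p.LoopsOK ∧ q.LoopsOK
  | .forLoop i b p => i ≠ 3 ∧ b ≠ 3 ∧ i ≠ b ∧ i ∉ p.varsWritten ∧ b ∉ p.varsWritten ∧ p.LoopsOK
  | _ => True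

instance decidableLoopsOK : (p : Cmd) → Decidable p.LoopsOK
  | skip => isTrue trivial
  | const _ _ => isTrue trivial
  | add _ _ _ => isTrue trivial
  | sub _ _ _ => isTrue trivial
  | load _ _ _ _ => isTrue trivial
  | store _ _ _ _ => isTrue trivial
  | seq p q => @instDecidableAnd _ _ (decidableLoopsOK p) (decidableLoopsOK q)
  | ite _ p q => @instDecidableAnd _ _ (decidableLoopsOK p) (decidableLoopsOK q)
  | .forLoop i b p => by
      have := decidableLoopsOK p
      unfold LoopsOK
      infer_instance

theorem var_counter_iterate {i b : ℕ} {p : Cmd} (hi : i ≠ 3) (hip : i ∉ p.varsWritten)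
    (s : State) (v : ℕ) (j : ℕ) :
    ((fun r => tick i b (p.run r))^[j] ((s.setVar i 0).setVar 3 v)).var i = j := by
  induction j with
  | zero => simp [hi]
  | succ j ih =>
    rw [Function.iterate_succ_apply']
    rw [tick_var, if_neg hi, if_pos rfl, run_var_of_notMem p hip, ih]

/-- Reasoning about a counting loop by an invariant. Each pass may use the value of the counter
and that whatever the loop does not write is as it was before the loop. -/
theorem run_for_induct {i b : ℕ} {p : Cmd} {s : State} (I : ℕ → State → Prop)
    (hok : LoopsOK (.forLoop i b p))
    (h0 : I 0 ((s.setVar i 0).setVar 3 (s.var b)))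
    (hstep : ∀ j r, j < s.var b → r.var i = j →
      (∀ x, x ∉ varsWritten (.forLoop i b p) → r.var x = s.var x) →
      (∀ a, a ∉ arrsWritten p → r.arr a = s.arr a) →
      I j r → I (j + 1) (tick i b (p.run r))) :
    I (s.var b) (run (.forLoop i b p) s) := by
  rw [run]
  suffices h : ∀ j ≤ s.var b,
      I j ((fun r => tick i b (p.run r))^[j] ((s.setVar i 0).setVar 3 (s.var b))) from
    h _ le_rfl
  intro j
  induction j with
  | zero => intro _; exact h0
  | succ j ih =>
    intro hj
    have hvar : ∀ x, x ∉ varsWritten (.forLoop i b p) → ∀ n,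
        ((fun r => tick i b (p.run r))^[n] ((s.setVar i 0).setVar 3 (s.var b))).var x =
          s.var x := by
      intro x hx n
      simp only [varsWritten, List.mem_cons, not_or] at hx
      induction n with
      | zero => simp [hx.1, hx.2.1]
      | succ n ihn =>
        rw [Function.iterate_succ_apply', ← ihn]
        simp [tick, hx.1, hx.2.1, run_var_of_notMem p hx.2.2]
    have harr : ∀ a, a ∉ arrsWritten p → ∀ n,
        ((fun r => tick i b (p.run r))^[n] ((s.setVar i 0).setVar 3 (s.var b))).arr a =
          s.arr a := by
      intro a ha n
      induction n with
      | zero => simp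
      | succ n ihn =>
        rw [Function.iterate_succ_apply', ← ihn]
        simp [tick, run_arr_of_notMem p ha]
    rw [Function.iterate_succ_apply']
    exact hstep j _ (by omega) (var_counter_iterate hok.1 hok.2.2.2.1 s _ j)
      (fun x hx => hvar x hx j) (fun a ha => harr a ha j) (ih (by omega))

/-- The loop bounds of a command. -/
def bounds : Cmd → List ℕ
  | seq p q => p.bounds ++ q.bounds
  | ite _ p q => p.bounds ++ q.bounds
  | .forLoop _ b p => b :: p.bounds
  | _ => []

open Polynomial in
/-- The number of steps of a command, as a polynomial in an upper bound on its loop bounds. -/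
noncomputable def time : Cmd → ℕ[X]
  | seq p q => p.time + q.time
  | ite _ p q => 1 + p.time + q.time
  | .forLoop _ _ p => 3 + X * (p.time + 4)
  | _ => 1

theorem tick_eq {i b : ℕ} (hi : i ≠ 3) (hb : b ≠ 3) (hib : i ≠ b) (r : State) :
    let u := (r.setVar 3 1).setVar i ((r.setVar 3 1).var i + (r.setVar 3 1).var 3)
    u.setVar 3 (u.var b - u.var i) = tick i b r := by
  simp only [tick, State.setVar, State.mk.injEq, and_true]
  funext y
  by_cases hy : y = 3
  · simp [hy, hi, hb, hib.symm]
  · by_cases hyi : y = i <;> simp [hy, hyi, hi]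

/-- A command whose loop bounds are at most `V` and are not overwritten runs in time polynomial
in `V`. -/
theorem exec_compile (p : Cmd) (hok : p.LoopsOK) (V : ℕ) (s : State)
    (hb : ∀ b ∈ p.bounds, b ∉ p.varsWritten ∧ s.var b ≤ V) :
    ∃ t, t ≤ p.time.eval V ∧ Exec p.compile s t (p.run s) := by
  induction p generalizing s with
  | skip => exact ⟨1, by simp [time], .skip s⟩
  | const x c => exact ⟨1, by simp [time], .const s x c⟩
  | add x y z => exact ⟨1, by simp [time], .add s x y z⟩
  | sub x y z => exact ⟨1, by simp [time], .sub s x y z⟩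
  | load x a i j => exact ⟨1, by simp [time], .load s x a i j⟩
  | store a i j x => exact ⟨1, by simp [time], .store s a i j x⟩
  | seq p q ihp ihq =>
    simp only [bounds, varsWritten, List.mem_append, not_or] at hb
    obtain ⟨t₁, h₁, e₁⟩ := ihp hok.1 s (fun b h => ⟨(hb b (.inl h)).1.1, (hb b (.inl h)).2⟩)
    obtain ⟨t₂, h₂, e₂⟩ := ihq hok.2 (p.run s) (fun b h => ⟨(hb b (.inr h)).1.2, by
      rw [run_var_of_notMem p (hb b (.inr h)).1.1]
      exact (hb b (.inr h)).2⟩)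
    refine ⟨t₁ + t₂, ?_, .seq e₁ e₂⟩
    simp only [time, Polynomial.eval_add]
    omega
  | ite x p q ihp ihq =>
    simp only [bounds, varsWritten, List.mem_append, not_or] at hb
    obtain ⟨t₁, h₁, e₁⟩ := ihp hok.1 s (fun b h => ⟨(hb b (.inl h)).1.1, (hb b (.inl h)).2⟩)
    obtain ⟨t₂, h₂, e₂⟩ := ihq hok.2 s (fun b h => ⟨(hb b (.inr h)).1.2, (hb b (.inr h)).2⟩)
    simp only [time, Polynomial.eval_add, Polynomial.eval_one, run_ite]
    split_ifs with hx
    · exact ⟨1 + t₁, by omega, .ite_pos hx e₁⟩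
    · exact ⟨1 + t₂, by omega, .ite_neg (not_not.1 hx) e₂⟩
  | forLoop i b p ih =>
    obtain ⟨hi, hb3, hib, hip, hbp, hok⟩ := hok
    simp only [bounds, varsWritten, List.mem_cons, not_or] at hb
    set F : State → State := fun r => tick i b (p.run r) with hF
    set s₀ := (s.setVar i 0).setVar 3 (s.var b) with hs₀
    -- the invariant that makes each pass run within the time bound
    let J : State → Prop := fun r => r.var b = s.var b ∧ ∀ c ∈ p.bounds, r.var c ≤ V
    have hJF : ∀ r, J r → J (F r) := by
      rintro r ⟨h1, h2⟩
      constructor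
      · simp [hF, tick, hb3, hib.symm, run_var_of_notMem p hbp, h1]
      · intro c hc
        obtain ⟨⟨h3, hci, hcp⟩, -⟩ := hb c (.inr hc)
        simpa [hF, tick, h3, hci, run_var_of_notMem p hcp] using h2 c hc
    have hJ0 : J s₀ := by
      constructor
      · simp [hs₀, hb3, hib.symm]
      · intro c hc
        obtain ⟨⟨h3, hci, -⟩, hV⟩ := hb c (.inr hc)
        simpa [hs₀, h3, hci] using hV
    have hloop : ∀ n r, J r → r.var i + n = s.var b → r.var 3 = n →
        ∃ t, t ≤ 1 + n * (p.time.eval V + 4) ∧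
          Exec (.loop 3 (.seq p.compile (.seq (.const 3 1) (.seq (.add i i 3) (.sub 3 b i)))))
            r t (F^[n] r) := by
      intro n
      induction n with
      | zero => exact fun r _ _ h3 => ⟨1, by simp, .loop_done h3⟩
      | succ n ihn =>
        intro r hJr hri h3
        obtain ⟨t₁, ht₁, e₁⟩ := ih hok r (fun c hc =>
          ⟨(hb c (.inr hc)).1.2.2, hJr.2 c hc⟩)
        have e₂ : Exec (.seq (.const 3 1) (.seq (.add i i 3) (.sub 3 b i))) (p.run r)
            (1 + (1 + 1)) (F r) := by
          have := tick_eq hi hb3 hib (p.run r)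
          simp only [hF]
          rw [← this]
          exact .seq (.const _ _ _) (.seq (.add _ _ _ _) (.sub _ _ _ _))
        obtain ⟨t₂, ht₂, e₃⟩ := ihn (F r) (hJF r hJr)
          (by simp only [hF, tick, State.setVar_var, hi, if_false, if_true,
                run_var_of_notMem p hip]; omega)
          (by simp only [hF, tick, State.setVar_var, if_true,
                run_var_of_notMem p hip, run_var_of_notMem p hbp, hJr.1]; omega)
        refine ⟨1 + (t₁ + (1 + (1 + 1))) + t₂, ?_, ?_⟩
        · rw [Nat.succ_mul]; omega
        · rw [Function.iterate_succ_apply]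
          exact .loop_step (by omega) (.seq e₁ e₂) e₃
    obtain ⟨t, ht, e⟩ := hloop (s.var b) s₀ hJ0 (by simp [hs₀, hi]) (by simp [hs₀])
    refine ⟨1 + (1 + t), ?_, .seq (.const _ _ _) (.seq (r := s₀) ?_ e)⟩
    · simp only [time, Polynomial.eval_add, Polynomial.eval_mul, Polynomial.eval_X,
        Polynomial.eval_ofNat]
      have hV : s.var b ≤ V := (hb b (.inl rfl)).2
      have := Nat.mul_le_mul_right (p.time.eval V + 4) hV
      omega
    · have := Exec.sub (s.setVar i 0) 3 b i
      simpa [hs₀, hib.symm] using this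

end Cmd

open Cmd

/-! ### The descent as a program -/

/-- Variable `11` becomes the total weight. -/
def sumWeights : Cmd :=
  .const 11 0 ;; .forLoop 10 1 (.load 12 3 5 10 ;; .add 11 11 12)

theorem run_sumWeights {s : State} (h5 : s.var 5 = 0) :
    (run sumWeights s).var 11 = ∑ c ∈ Finset.range (s.var 1), s.arr 3 0 c := by
  rw [sumWeights, run_seq]
  refine run_for_induct (fun j r => r.var 11 = ∑ c ∈ Finset.range j, s.arr 3 0 c)
    (by decide) (by simp) ?_
  intro j r _ hj hv ha hI
  have h5r := hv 5 (by decide)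
  have h3r := ha 3 (by decide)
  simp at h5r h3r
  simp [tick_var, hI, hj, h5r, h3r, h5, Finset.sum_range_succ]

/-- Variable `14` becomes the weight of the ballot of voter `13`. -/
def sumBallot : Cmd :=
  .const 14 0 ;; .forLoop 10 1 (.load 15 2 13 10 ;;
    .ite 15 (.load 12 3 5 10 ;; .add 14 14 12) .skip)

theorem run_sumBallot {s : State} (h5 : s.var 5 = 0) :
    (run sumBallot s).var 14 =
      ∑ c ∈ Finset.range (s.var 1), if s.arr 2 (s.var 13) c ≠ 0 then s.arr 3 0 c else 0 := by
  rw [sumBallot, run_seq]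
  refine run_for_induct (fun j r => r.var 14 =
    ∑ c ∈ Finset.range j, if s.arr 2 (s.var 13) c ≠ 0 then s.arr 3 0 c else 0)
    (by decide) (by simp) ?_
  intro j r _ hj hv ha hI
  have h5r := hv 5 (by decide)
  have h13r := hv 13 (by decide)
  have h3r := ha 3 (by decide)
  have h2r := ha 2 (by decide)
  simp at h5r h13r h3r h2r
  rw [Finset.sum_range_succ, ← hI]
  by_cases h : s.arr 2 (s.var 13) j = 0 <;>
    simp [run_ite, tick_var, hj, h5r, h3r, h2r, h13r, h5, h]

/-- All weights are decreased by one. -/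
def decWeights : Cmd :=
  .forLoop 10 1 (.load 12 3 5 10 ;; .sub 12 12 6 ;; .store 3 5 10 12)

theorem run_decWeights {s : State} (h5 : s.var 5 = 0) (h6 : s.var 6 = 1) (c : ℕ) :
    (run decWeights s).arr 3 0 c =
      if c < s.var 1 then s.arr 3 0 c - 1 else s.arr 3 0 c := by
  revert c
  refine run_for_induct (fun j r => ∀ c, r.arr 3 0 c =
    if c < j then s.arr 3 0 c - 1 else s.arr 3 0 c) (by decide) (by simp) ?_
  intro j r _ hj hv ha hI c
  have h5r := hv 5 (by decide)
  have h6r := hv 6 (by decide)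
  rcases lt_trichotomy c j with h | h | h
  · simp [hj, h5r, h6r, h5, h6, hI, h, h.ne, Nat.lt_succ_of_lt h]
  · simp [hj, h5r, h6r, h5, h6, hI, h]
  · simp [hj, h5r, h6r, h5, h6, hI, h.ne', h.not_gt, Nat.not_le_of_lt h]

/-- Variable `16` becomes the objective of the relaxation, and row `0` of array `4` records how
much the weight of each ballot falls short of `N`, which is held in variable `8`. -/
def measure : Cmd :=
  .const 16 0 ;; .forLoop 13 4 (sumBallot ;; .sub 17 8 14 ;; .store 4 5 13 17 ;;
    .ite 17 (.add 16 16 14) (.add 16 16 8))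

/-- The weight of the ballot in row `v` of the approval matrix in array `2`. -/
def ballotWeight (s : State) (v : ℕ) : ℕ :=
  ∑ c ∈ Finset.range (s.var 1), if s.arr 2 v c ≠ 0 then s.arr 3 0 c else 0

theorem run_measure {s : State} (h5 : s.var 5 = 0) :
    (run measure s).var 16 =
        ∑ v ∈ Finset.range (s.var 4), min (s.var 8) (ballotWeight s v) ∧
      ∀ v < s.var 4, (run measure s).arr 4 0 v = s.var 8 - ballotWeight s v := by
  rw [measure, run_seq]
  refine run_for_induct (fun j r =>
    r.var 16 = ∑ v ∈ Finset.range j, min (s.var 8) (ballotWeight s v) ∧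
      ∀ v < j, r.arr 4 0 v = s.var 8 - ballotWeight s v)
    (by decide) (by simp) ?_
  rintro j r _ hj hv ha ⟨hI, hI'⟩
  have h5r := hv 5 (by decide)
  have h8r := hv 8 (by decide)
  have h1r := hv 1 (by decide)
  have h3r := ha 3 (by decide)
  have h2r := ha 2 (by decide)
  simp at h5r h8r h1r h3r h2r
  have hsum := run_sumBallot (s := r) (h5r.trans h5)
  rw [h1r, hj, h2r, h3r, ← ballotWeight] at hsum
  set q := run sumBallot r with hq
  have h5q : q.var 5 = 0 := by rw [hq, run_var_of_notMem _ (by decide), h5r, h5]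
  have h8q : q.var 8 = s.var 8 := by rw [hq, run_var_of_notMem _ (by decide), h8r]
  have h13q : q.var 13 = j := by rw [hq, run_var_of_notMem _ (by decide), hj]
  have h16q : q.var 16 = r.var 16 := by rw [hq, run_var_of_notMem _ (by decide)]
  have h4q : q.arr 4 = r.arr 4 := by rw [hq, run_arr_of_notMem _ (by decide)]
  constructor
  · rw [Finset.sum_range_succ, ← hI]
    by_cases h : s.var 8 - ballotWeight s j = 0
    · simp [run_ite, tick_var, ← hq, hsum, h5q, h8q, h13q, h16q, h,
        min_eq_left (Nat.sub_eq_zero_iff_le.1 h)]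
    · have h' : ballotWeight s j ≤ s.var 8 := by omega
      simp [run_ite, tick_var, ← hq, hsum, h5q, h8q, h13q, h16q, h, min_eq_right h']
  · intro v hvj
    have hcase : (tick 13 4 (run (sumBallot ;; .sub 17 8 14 ;; .store 4 5 13 17 ;;
        .ite 17 (.add 16 16 14) (.add 16 16 8)) r)).arr 4 0 v =
        if v = j then s.var 8 - ballotWeight s j else r.arr 4 0 v := by
      simp only [run_seq, tick_arr]
      rw [run_arr_of_notMem (.ite 17 (.add 16 16 14) (.add 16 16 8)) (by decide), ← hq]
      simp [h5q, h8q, h13q, hsum, h4q]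
    rw [hcase]
    split_ifs with h
    · rw [h]
    · exact hI' v (by omega)

/-- The weights of the available candidates on the ballot of voter `13` are increased by one. -/
def addBallot : Cmd :=
  .forLoop 10 1 (.load 15 2 13 10 ;;
    .ite 15 (.load 12 3 5 10 ;; .load 18 1 5 10 ;; .add 12 12 18 ;; .store 3 5 10 12) .skip)

theorem run_addBallot {s : State} (h5 : s.var 5 = 0) (c : ℕ) :
    (run addBallot s).arr 3 0 c = s.arr 3 0 c +
      if c < s.var 1 ∧ s.arr 2 (s.var 13) c ≠ 0 then s.arr 1 0 c else 0 := by
  revert c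
  refine run_for_induct (fun j r => ∀ c, r.arr 3 0 c = s.arr 3 0 c +
    if c < j ∧ s.arr 2 (s.var 13) c ≠ 0 then s.arr 1 0 c else 0) (by decide) (by simp) ?_
  intro j r _ hj hv ha hI c
  have h5r := hv 5 (by decide)
  have h13r := hv 13 (by decide)
  have h1r := ha 1 (by decide)
  have h2r := ha 2 (by decide)
  by_cases h : s.arr 2 (s.var 13) j = 0
  · have hlt : (c < j + 1 ∧ s.arr 2 (s.var 13) c ≠ 0) ↔ (c < j ∧ s.arr 2 (s.var 13) c ≠ 0) := by
      constructor
      · rintro ⟨h1, h2⟩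
        have : c ≠ j := fun hcj => h2 (hcj ▸ h)
        exact ⟨by omega, h2⟩
      · exact fun ⟨h1, h2⟩ => ⟨by omega, h2⟩
    simp only [hlt]
    simp [run_ite, hj, h2r, h13r, h, hI c]
  · rcases eq_or_ne c j with rfl | hne
    · simp [run_ite, hj, h2r, h1r, h13r, h5r, h5, h, hI c]
    · have hlt : c < j + 1 ↔ c < j := by omega
      simp [run_ite, hj, h2r, h1r, h13r, h5r, h5, h, hI c, hne, hlt]

/-- The subgradient of the objective is added to the weights. -/
def addLowBallots : Cmd :=
  .forLoop 13 4 (.load 17 4 5 13 ;; .ite 17 addBallot .skip)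

theorem run_addLowBallots {s : State} (h5 : s.var 5 = 0) (c : ℕ) (hc : c < s.var 1) :
    (run addLowBallots s).arr 3 0 c = s.arr 3 0 c +
      ∑ v ∈ Finset.range (s.var 4),
        if s.arr 4 0 v ≠ 0 ∧ s.arr 2 v c ≠ 0 then s.arr 1 0 c else 0 := by
  refine run_for_induct (fun j r => r.arr 3 0 c = s.arr 3 0 c +
    ∑ v ∈ Finset.range j, if s.arr 4 0 v ≠ 0 ∧ s.arr 2 v c ≠ 0 then s.arr 1 0 c else 0)
    (by decide) (by simp) ?_
  intro j r _ hj hv ha hI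
  have h5r := hv 5 (by decide)
  have h1r := hv 1 (by decide)
  have ha1 := ha 1 (by decide)
  have ha2 := ha 2 (by decide)
  have ha4 := ha 4 (by decide)
  rw [Finset.sum_range_succ, ← add_assoc, ← hI]
  by_cases h : s.arr 4 0 j = 0
  · simp [run_ite, hj, h5r, h5, ha4, h]
  · simp only [run_seq, run_load, run_ite, tick_arr, State.setVar_var, if_true, h5r, h5, hj,
      ha4, h, ne_eq, not_false_iff, true_and]
    rw [run_addBallot (by simp [h5r, h5])]
    simp [hj, h1r, ha1, ha2, hc]

/-- One step of the descent. Variables `19`, `21` and `22` hold the bound on the total weight,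
the tolerance and the goal; variable `20` tells whether the weights were settled. -/
def descend : Cmd :=
  sumWeights ;; .sub 17 11 19 ;;
    .ite 17 (decWeights ;; .const 20 0)
      (measure ;; .add 16 16 21 ;; .sub 17 16 22 ;;
        .ite 17 (.const 20 1) (addLowBallots ;; .const 20 0))

/-- The weights of the candidates in memory. -/
def weights (m : ℕ) (s : State) : Fin m → ℕ := fun c => s.arr 3 0 c

/-- The memory `s` holds an approval profile `A` in array `2`, a set `S` of available candidates
in row `0` of array `1`, and the constants `0` and `1`. -/
structure Holds {n m : ℕ} (A : Fin n → Finset (Fin m)) (S : Finset (Fin m)) (s : State) :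
    Prop where
  cands : s.var 1 = m
  rows : s.var 4 = n
  zero : s.var 5 = 0
  one : s.var 6 = 1
  ballots : ∀ (v : Fin n) (c : Fin m), s.arr 2 v c ≠ 0 ↔ c ∈ A v
  avail : ∀ c : Fin m, s.arr 1 0 c = if c ∈ S then 1 else 0

theorem Holds.of_frame {n m : ℕ} {A : Fin n → Finset (Fin m)} {S : Finset (Fin m)}
    {s r : State} (h : Holds A S s) (h1 : r.var 1 = s.var 1) (h4 : r.var 4 = s.var 4)
    (h5 : r.var 5 = s.var 5) (h6 : r.var 6 = s.var 6) (ha1 : r.arr 1 = s.arr 1)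
    (ha2 : r.arr 2 = s.arr 2) : Holds A S r :=
  ⟨h1.trans h.cands, h4.trans h.rows, h5.trans h.zero, h6.trans h.one,
    fun v c => by rw [ha2]; exact h.ballots v c, fun c => by rw [ha1]; exact h.avail c⟩

theorem Holds.run {n m : ℕ} {A : Fin n → Finset (Fin m)} {S : Finset (Fin m)} {s : State}
    (h : Holds A S s) (p : Cmd) (hv : ∀ x ∈ [1, 4, 5, 6], x ∉ p.varsWritten)
    (ha : ∀ a ∈ [1, 2], a ∉ p.arrsWritten) : Holds A S (p.run s) :=
  h.of_frame (run_var_of_notMem p (hv 1 (by decide)) s)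
    (run_var_of_notMem p (hv 4 (by decide)) s) (run_var_of_notMem p (hv 5 (by decide)) s)
    (run_var_of_notMem p (hv 6 (by decide)) s) (run_arr_of_notMem p (ha 1 (by decide)) s)
    (run_arr_of_notMem p (ha 2 (by decide)) s)

theorem Holds.ballotWeight_eq {n m : ℕ} {A : Fin n → Finset (Fin m)} {S : Finset (Fin m)}
    {s : State} (h : Holds A S s) (v : Fin n) :
    ballotWeight s v = ∑ c ∈ A v, weights m s c := by
  rw [ballotWeight, h.cands, Finset.sum_range]
  simp only [h.ballots]
  rw [← Finset.sum_filter, Finset.filter_univ_mem]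
  rfl

theorem Holds.run_measure {n m : ℕ} {A : Fin n → Finset (Fin m)} {S : Finset (Fin m)}
    {s : State} (h : Holds A S s) :
    (Cmd.run measure s).var 16 = fracCoverage A (s.var 8) (weights m s) := by
  rw [(RAM.run_measure h.zero).1, h.rows, Finset.sum_range]
  simp only [h.ballotWeight_eq, fracCoverage]

/-- The program performs one step of the descent. -/
theorem Holds.run_descend {n m : ℕ} {A : Fin n → Finset (Fin m)} {S : Finset (Fin m)}
    {s : State} (h : Holds A S s) :
    weights m (Cmd.run descend s) =
        descentStep A S (s.var 8) (s.var 19) (s.var 21) (s.var 22) (weights m s) ∧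
      ((Cmd.run descend s).var 20 ≠ 0 ↔
        IsSettled A (s.var 8) (s.var 19) (s.var 21) (s.var 22) (weights m s)) := by
  have htot : (Cmd.run sumWeights s).var 11 = ∑ c, weights m s c := by
    rw [run_sumWeights h.zero, h.cands, Finset.sum_range]
    rfl
  set s₁ := (Cmd.run sumWeights s).setVar 17 (∑ c, weights m s c - s.var 19) with hs₁
  have hs₁' : Cmd.run (sumWeights ;; .sub 17 11 19) s = s₁ := by
    rw [run_seq, run_sub, htot, run_var_of_notMem sumWeights (x := 19) (by decide)]
  have hv : ∀ x ∉ [3, 10, 11, 12, 17], s₁.var x = s.var x := by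
    intro x hx
    rw [← hs₁']
    refine run_var_of_notMem _ ?_ s
    simp only [List.mem_cons, List.not_mem_nil, or_false, not_or] at hx
    simp [varsWritten, sumWeights, hx]
  have ha : ∀ a, s₁.arr a = s.arr a := by
    intro a
    rw [← hs₁']
    exact run_arr_of_notMem _ (by simp [arrsWritten, sumWeights]) s
  have hH : Holds A S s₁ := h.of_frame (hv 1 (by decide)) (hv 4 (by decide)) (hv 5 (by decide))
    (hv 6 (by decide)) (ha 1) (ha 2)
  have hw : weights m s₁ = weights m s := by
    funext c
    simp [weights, ha]
  have h17 : s₁.var 17 = ∑ c, weights m s c - s.var 19 := by simp [hs₁]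
  have hrun : Cmd.run descend s = Cmd.run (.ite 17 (decWeights ;; .const 20 0)
      (measure ;; .add 16 16 21 ;; .sub 17 16 22 ;;
        .ite 17 (.const 20 1) (addLowBallots ;; .const 20 0))) s₁ := by
    rw [← hs₁']
    rfl
  rw [hrun, run_ite, h17, descentStep, IsSettled]
  by_cases hlim : s.var 19 < ∑ c, weights m s c
  · rw [if_pos (by omega), if_pos hlim]
    constructor
    · funext c
      simp [weights, run_decWeights hH.zero hH.one, hH.cands, ha]
    · simp [hlim]
  rw [if_neg (by omega), if_neg hlim]
  have hF : (Cmd.run measure s₁).var 16 = fracCoverage A (s.var 8) (weights m s) := by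
    rw [hH.run_measure, hw, hv 8 (by decide)]
  simp only [run_seq, run_add, run_sub, State.setVar_var, hF,
    run_var_of_notMem measure (x := 21) (by decide),
    run_var_of_notMem measure (x := 22) (by decide), hv 21 (by decide), hv 22 (by decide)]
  norm_num
  set F := fracCoverage A (s.var 8) (weights m s)
  set s₂ := ((Cmd.run measure s₁).setVar 16 (F + s.var 21)).setVar 17
    (F + s.var 21 - s.var 22) with hs₂
  have hv₂ : ∀ x ∈ [1, 4, 5, 6], s₂.var x = s₁.var x := by
    intro x hx
    have hx' : x ∉ varsWritten (measure ;; .const 16 0 ;; .const 17 0) := by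
      revert x; decide
    simp only [varsWritten, List.mem_append, not_or, List.mem_singleton] at hx'
    simp only [hs₂, State.setVar_var, if_neg hx'.2.2, if_neg hx'.2.1,
      run_var_of_notMem measure hx'.1]
  have ha₂ : ∀ a, a ≠ 4 → s₂.arr a = s.arr a := by
    intro a ha4
    simp only [hs₂, State.setVar_arr]
    rw [run_arr_of_notMem measure (by simp [arrsWritten, measure, sumBallot, ha4]), ha]
  rw [run_ite]
  by_cases hQ : s.var 22 < F + s.var 21
  · have : s₂.var 17 ≠ 0 := by simp [hs₂]; omega
    rw [if_pos this, if_pos hQ]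
    constructor
    · funext c
      simp [weights, ha₂]
    · simp [hQ, not_lt.1 hlim]
  · have : ¬ s₂.var 17 ≠ 0 := by simp [hs₂]; omega
    rw [if_neg this, if_neg hQ]
    constructor
    · funext c
      have h5 : s₂.var 5 = 0 := by rw [hv₂ 5 (by decide), hH.zero]
      simp only [run_seq, run_const]
      change (Cmd.run addLowBallots s₂).arr 3 0 c = _
      rw [run_addLowBallots h5 c (by rw [hv₂ 1 (by decide), hH.cands]; exact c.2),
        hv₂ 4 (by decide), hH.rows, Finset.sum_range, ha₂ 3 (by decide), ha₂ 1 (by decide),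
        ha₂ 2 (by decide), h.avail]
      refine congrArg (weights m s c + ·) ?_
      have h4 : ∀ v : Fin n, s₂.arr 4 0 v = s.var 8 - ∑ d ∈ A v, weights m s d := by
        intro v
        simp only [hs₂, State.setVar_arr]
        rw [(RAM.run_measure hH.zero).2 v (by rw [hH.rows]; exact v.2), hH.ballotWeight_eq,
          hw, hv 8 (by decide)]
      simp only [h4, h.ballots]
      split_ifs with hcS
      · rw [Finset.card_filter]
        refine Finset.sum_congr rfl fun v _ => ?_
        have : (s.var 8 - ∑ d ∈ A v, weights m s d ≠ 0 ∧ c ∈ A v) ↔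
            (∑ d ∈ A v, weights m s d < s.var 8 ∧ c ∈ A v) := by
          rw [Nat.sub_ne_zero_iff_lt]
        exact if_congr this rfl rfl
      · simp
    · simp [hQ]

/-! ### Finding an optimal committee -/

/-- Some committee of size at most `k` inside `S` covers `t` ballots. -/
def CanCover {n m : ℕ} (A : Fin n → Finset (Fin m)) (S : Finset (Fin m)) (k t : ℕ) : Prop :=
  ∃ W ⊆ S, W.card ≤ k ∧ t ≤ coverage A W

/-- The parameters of the descent held in `s` (the unit `N`, the number `T` of steps, the bound
on the total weight, and the tolerance) are large enough for it to decide `CanCover`. -/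
structure Tuned (n m k : ℕ) (s : State) : Prop where
  exists_slack : ∃ B, s.var 19 + 1 = k * s.var 8 + B ∧ m < 2 * B ∧
    s.var 21 + B * n ≤ s.var 8
  tol : m * n ^ 2 ≤ s.var 21
  tol_pos : 0 < s.var 21
  steps : k * s.var 8 ^ 2 < s.var 9

theorem Tuned.of_frame {n m k : ℕ} {s r : State} (h : Tuned n m k s) (h8 : r.var 8 = s.var 8)
    (h9 : r.var 9 = s.var 9) (h19 : r.var 19 = s.var 19) (h21 : r.var 21 = s.var 21) :
    Tuned n m k r := by
  refine ⟨?_, ?_, ?_, ?_⟩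
  · rw [h19, h8, h21]; exact h.exists_slack
  · rw [h21]; exact h.tol
  · rw [h21]; exact h.tol_pos
  · rw [h8, h9]; exact h.steps

/-- All weights become zero. -/
def clearWeights : Cmd := .forLoop 10 1 (.store 3 5 10 5)

theorem run_clearWeights {s : State} (h5 : s.var 5 = 0) :
    ∀ c < s.var 1, (run clearWeights s).arr 3 0 c = 0 := by
  refine run_for_induct (fun j r => ∀ c < j, r.arr 3 0 c = 0) (by decide) (by simp) ?_
  intro j r _ hj hv _ hI c hc
  have h5r := hv 5 (by decide)
  rcases eq_or_ne c j with rfl | hne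
  · simp [hj, h5r, h5]
  · simp [hj, h5r, h5, hne, hI c (by omega)]

/-- Variable `20` tells whether the goal in variable `22` can be reached. -/
def testGoal : Cmd := clearWeights ;; .forLoop 23 9 descend ;; descend

theorem Holds.run_testGoal {n m k t : ℕ} {A : Fin n → Finset (Fin m)} {S : Finset (Fin m)}
    {s : State} {f : Fin m → ℝ} (hconv : ConvexBallots A S f) (h : Holds A S s)
    (ht : Tuned n m k s) (h22 : s.var 22 = t * s.var 8) :
    (Cmd.run testGoal s).var 20 ≠ 0 ↔ CanCover A S k t := by
  rw [testGoal, run_seq, run_seq]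
  set s₁ := Cmd.run clearWeights s with hs₁
  have hv₁ : ∀ x ∈ [8, 9, 19, 21, 22], s₁.var x = s.var x := fun x hx =>
    run_var_of_notMem _ (by revert x; decide) s
  have hH₁ : Holds A S s₁ := h.run _ (by decide) (by decide)
  have hw₁ : weights m s₁ = 0 := by
    funext c
    exact run_clearWeights h.zero c (by rw [h.cands]; exact c.2)
  have hloop : weights m (Cmd.run (.forLoop 23 9 descend) s₁) =
      (descentStep A S (s.var 8) (s.var 19) (s.var 21) (t * s.var 8))^[s.var 9] 0 := by
    rw [← hv₁ 9 (by decide)]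
    refine run_for_induct (s := s₁) (fun j r => weights m r =
      (descentStep A S (s.var 8) (s.var 19) (s.var 21) (t * s.var 8))^[j] 0)
      (by decide) ?_ ?_
    · exact hw₁
    · intro j r _ _ hv ha hI
      have hHr : Holds A S r := hH₁.of_frame (hv 1 (by decide)) (hv 4 (by decide))
        (hv 5 (by decide)) (hv 6 (by decide)) (ha 1 (by decide)) (ha 2 (by decide))
      rw [Function.iterate_succ_apply', ← hI, ← h22, ← hv₁ 8 (by decide),
        ← hv₁ 19 (by decide), ← hv₁ 21 (by decide), ← hv₁ 22 (by decide),
        ← hv 8 (by decide), ← hv 19 (by decide), ← hv 21 (by decide), ← hv 22 (by decide)]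
      exact hHr.run_descend.1
  set s₂ := Cmd.run (.forLoop 23 9 descend) s₁ with hs₂
  have hv₂ : ∀ x ∈ [8, 19, 21, 22], s₂.var x = s.var x := fun x hx =>
    (run_var_of_notMem _ (by revert x; decide) s₁).trans (hv₁ x (by revert x; decide))
  have hH₂ : Holds A S s₂ := hH₁.run _ (by decide) (by decide)
  rw [hH₂.run_descend.2, hloop, hv₂ 8 (by decide), hv₂ 19 (by decide), hv₂ 21 (by decide),
    hv₂ 22 (by decide), h22]
  obtain ⟨B, hB, hmB, hBN⟩ := ht.exists_slack
  exact isSettled_iterate_descentStep_iff hconv hB (by simpa using hmB) (by simpa using ht.tol)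
    ht.tol_pos (by simpa using hBN) ht.steps

/-- The goal in variable `22` is lowered until it can be reached. -/
def findGoal : Cmd :=
  .forLoop 24 4 (testGoal ;; .ite 20 .skip (.sub 22 22 8))

theorem Holds.run_findGoal {n m k : ℕ} {A : Fin n → Finset (Fin m)} {S : Finset (Fin m)}
    {s : State} {f : Fin m → ℝ} (hconv : ConvexBallots A S f) (h : Holds A S s)
    (ht : Tuned n m k s) (h22 : s.var 22 = n * s.var 8) :
    ∃ t, (Cmd.run findGoal s).var 22 = t * s.var 8 ∧ CanCover A S k t ∧
      ∀ U ⊆ S, U.card ≤ k → coverage A U ≤ t := by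
  have key : ∃ t, (Cmd.run findGoal s).var 22 = t * s.var 8 ∧
      (∀ U ⊆ S, U.card ≤ k → coverage A U ≤ t) ∧
      (CanCover A S k t ∨ t + s.var 4 ≤ n) := by
    refine run_for_induct (s := s) (fun j r => ∃ t, r.var 22 = t * s.var 8 ∧
      (∀ U ⊆ S, U.card ≤ k → coverage A U ≤ t) ∧ (CanCover A S k t ∨ t + j ≤ n))
      (by decide) ?_ ?_
    · refine ⟨n, by simpa using h22, fun U _ _ => ?_, Or.inr le_rfl⟩
      exact (Finset.card_le_univ _).trans (by simp)
    · rintro j r hjn _ hv ha ⟨t, h22r, hU, hor⟩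
      have hHr : Holds A S r := h.of_frame (hv 1 (by decide)) (hv 4 (by decide))
        (hv 5 (by decide)) (hv 6 (by decide)) (ha 1 (by decide)) (ha 2 (by decide))
      have htr : Tuned n m k r := ht.of_frame (hv 8 (by decide)) (hv 9 (by decide))
        (hv 19 (by decide)) (hv 21 (by decide))
      have h8r := hv 8 (by decide)
      have htest := hHr.run_testGoal hconv htr (h22r.trans (by rw [h8r]))
      have h22' : (Cmd.run testGoal r).var 22 = t * s.var 8 := by
        rw [run_var_of_notMem testGoal (by decide), h22r]
      have h8' : (Cmd.run testGoal r).var 8 = s.var 8 := by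
        rw [run_var_of_notMem testGoal (by decide), h8r]
      simp only [run_seq, run_ite]
      by_cases hcan : CanCover A S k t
      · rw [if_pos (htest.2 hcan)]
        exact ⟨t, by simp [tick_var, h22'], hU, Or.inl hcan⟩
      · rw [if_neg (fun h => hcan (htest.1 h))]
        refine ⟨t - 1, ?_, fun U hUS hUk => ?_, Or.inr ?_⟩
        · simp [tick_var, h22', h8', Nat.sub_mul]
        · have : ¬ t ≤ coverage A U := fun hle => hcan ⟨U, hUS, hUk, hle⟩
          omega
        · have hjt := hor.resolve_left hcan
          have : t ≠ 0 := fun h0 => hcan ⟨∅, Finset.empty_subset _, by simp, by omega⟩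
          omega
  obtain ⟨t, h1, h2, h3⟩ := key
  refine ⟨t, h1, ?_, h2⟩
  rcases h3 with h3 | h3
  · exact h3
  · rw [h.rows] at h3
    exact ⟨∅, Finset.empty_subset _, by simp, by omega⟩

/-- Every candidate without which the goal can still be reached is made unavailable. -/
def prune : Cmd :=
  .forLoop 25 1 (.store 1 5 25 5 ;; testGoal ;; .ite 20 .skip (.store 1 5 25 6))

/-- Once no available candidate can be spared, a committee reaching the goal consists of all the
available candidates. -/
theorem Holds.run_prune {n m k t : ℕ} {A : Fin n → Finset (Fin m)} {S : Finset (Fin m)}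
    {s : State} {f : Fin m → ℝ} (hconv : ConvexBallots A S f) (h : Holds A S s)
    (ht : Tuned n m k s) (h22 : s.var 22 = t * s.var 8) (hcan : CanCover A S k t) :
    ∃ W, Holds A W (Cmd.run prune s) ∧ W.card ≤ k ∧ t ≤ coverage A W := by
  have key : ∃ S', Holds A S' (Cmd.run prune s) ∧ S' ⊆ S ∧ CanCover A S' k t ∧
      ∀ c ∈ S', (c : ℕ) < s.var 1 → ¬ CanCover A (S'.erase c) k t := by
    refine run_for_induct (s := s) (fun j r => ∃ S', Holds A S' r ∧ S' ⊆ S ∧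
      CanCover A S' k t ∧ ∀ c ∈ S', (c : ℕ) < j → ¬ CanCover A (S'.erase c) k t)
      (by decide) ?_ ?_
    · exact ⟨S, h.of_frame (by simp) (by simp) (by simp) (by simp) (by simp) (by simp),
        subset_rfl, hcan, by simp⟩
    · rintro j r hjm hj hv ha ⟨S', hHr, hSS, hcanr, hmin⟩
      rw [h.cands] at hjm
      let c₀ : Fin m := ⟨j, hjm⟩
      set q := r.setArr 1 0 j 0 with hq
      have hHq : Holds A (S'.erase c₀) q := by
        refine ⟨hHr.cands, hHr.rows, hHr.zero, hHr.one, ?_, ?_⟩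
        · intro v c
          rw [← hHr.ballots v c]
          simp [hq]
        · intro c
          have hc : (c : ℕ) = j ↔ c = c₀ := by simp [c₀, Fin.ext_iff]
          simp only [hq, State.setArr_arr, true_and, hc, hHr.avail, Finset.mem_erase]
          by_cases hcc : c = c₀ <;> simp [hcc]
      have htq : Tuned n m k q := ht.of_frame (hv 8 (by decide)) (hv 9 (by decide))
        (hv 19 (by decide)) (hv 21 (by decide))
      have h22q : q.var 22 = t * q.var 8 := by
        simp only [hq, State.setArr_var]
        rw [hv 22 (by decide), hv 8 (by decide), h22]
      have htest := hHq.run_testGoal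
        (fun v i hi l hl o ho => hconv v i (hSS (Finset.mem_of_mem_erase hi)) l
          (hSS (Finset.mem_of_mem_erase hl)) o (hSS (Finset.mem_of_mem_erase ho))) htq h22q
      have hHu : Holds A (S'.erase c₀) (Cmd.run testGoal q) := hHq.run _ (by decide) (by decide)
      have h25 : (Cmd.run testGoal q).var 25 = j := by
        rw [run_var_of_notMem testGoal (by decide)]
        exact hj
      have hrun : Cmd.run (.store 1 5 25 5 ;; testGoal ;; .ite 20 .skip (.store 1 5 25 6)) r =
          Cmd.run (.ite 20 .skip (.store 1 5 25 6)) (Cmd.run testGoal q) := by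
        rw [run_seq, run_seq, run_store, hHr.zero, hj]
      rw [hrun, run_ite]
      by_cases hspare : CanCover A (S'.erase c₀) k t
      · rw [if_pos (htest.2 hspare)]
        refine ⟨S'.erase c₀, hHu.of_frame (by simp [tick_var]) (by simp [tick_var])
          (by simp [tick_var]) (by simp [tick_var]) (by simp) (by simp),
          (Finset.erase_subset _ _).trans hSS, hspare, ?_⟩
        rintro c hc hcj ⟨W, hWS, hW⟩
        obtain ⟨hc1, hc2⟩ := Finset.mem_erase.1 hc
        refine hmin c hc2 ?_ ⟨W, fun x hx => ?_, hW⟩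
        · have : (c : ℕ) ≠ j := fun h => hc1 (Fin.ext h)
          omega
        · have := hWS hx
          simp only [Finset.mem_erase] at this ⊢
          tauto
      · rw [if_neg (fun h => hspare (htest.1 h))]
        have hc₀ : c₀ ∈ S' := by
          by_contra hn
          rw [Finset.erase_eq_of_notMem hn] at hspare
          exact hspare hcanr
        refine ⟨S', ?_, hSS, hcanr, ?_⟩
        · refine ⟨?_, ?_, ?_, ?_, ?_, ?_⟩
          · simp [tick_var, hHu.cands]
          · simp [tick_var, hHu.rows]
          · simp [tick_var, hHu.zero]
          · simp [tick_var, hHu.one]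
          · intro v c
            rw [← hHu.ballots v c]
            simp
          · intro c
            have hc : (c : ℕ) = j ↔ c = c₀ := by simp [c₀, Fin.ext_iff]
            simp only [tick_arr, run_store, State.setArr_arr, hHu.zero, h25, hHu.one, true_and,
              hc, hHu.avail, Finset.mem_erase]
            by_cases hcc : c = c₀ <;> simp [hcc, hc₀]
        · intro c hc hcj
          rcases eq_or_ne (c : ℕ) j with h | h
          · have : c = c₀ := Fin.ext h
            rwa [this]
          · exact hmin c hc (by omega)
  obtain ⟨W, hH, -, ⟨U, hUW, hUk, hUt⟩, hmin⟩ := key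
  have hWU : W = U := by
    refine Finset.Subset.antisymm (fun c hc => ?_) hUW
    by_contra hcU
    refine hmin c hc (by rw [h.cands]; exact c.2) ⟨U, fun x hx => ?_, hUk, hUt⟩
    exact Finset.mem_erase.2 ⟨fun hxc => hcU (hxc ▸ hx), hUW hx⟩
  exact ⟨W, hH, hWU ▸ hUk, hWU ▸ hUt⟩

/-- Variable `26` becomes the number of available candidates. -/
def countAvail : Cmd := .const 26 0 ;; .forLoop 10 1 (.load 12 1 5 10 ;; .add 26 26 12)

theorem Holds.run_countAvail {n m : ℕ} {A : Fin n → Finset (Fin m)} {S : Finset (Fin m)}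
    {s : State} (h : Holds A S s) : (Cmd.run countAvail s).var 26 = S.card := by
  have : (Cmd.run countAvail s).var 26 = ∑ c ∈ Finset.range (s.var 1), s.arr 1 0 c := by
    rw [countAvail, run_seq]
    refine run_for_induct (fun j r => r.var 26 = ∑ c ∈ Finset.range j, s.arr 1 0 c)
      (by decide) (by simp) ?_
    intro j r _ hj hv ha hI
    have h5r := hv 5 (by decide)
    have h1r := ha 1 (by decide)
    simp at h5r h1r
    simp [tick_var, hI, hj, h5r, h1r, h.zero, Finset.sum_range_succ]
  rw [this, h.cands, Finset.sum_range]
  simp [h.avail]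

/-- Candidates are made available until their number, in variable `26`, is that in
variable `2`. -/
def fill : Cmd :=
  .forLoop 10 1 (.load 12 1 5 10 ;; .ite 12 .skip
    (.sub 17 2 26 ;; .ite 17 (.store 1 5 10 6 ;; .add 26 26 6) .skip))

theorem Holds.run_fill {n m : ℕ} {A : Fin n → Finset (Fin m)} {S : Finset (Fin m)}
    {s : State} (h : Holds A S s) (h26 : s.var 26 = S.card) (hS : S.card ≤ s.var 2)
    (hm : s.var 2 ≤ m) :
    ∃ W, S ⊆ W ∧ Holds A W (Cmd.run fill s) ∧ W.card = s.var 2 := by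
  have key : ∃ W, S ⊆ W ∧ Holds A W (Cmd.run fill s) ∧
      (Cmd.run fill s).var 26 = W.card ∧ W.card ≤ s.var 2 ∧
      (W.card = s.var 2 ∨ ∀ c : Fin m, (c : ℕ) < s.var 1 → c ∈ W) := by
    refine run_for_induct (s := s) (fun j r => ∃ W, S ⊆ W ∧ Holds A W r ∧
      r.var 26 = W.card ∧ W.card ≤ s.var 2 ∧
      (W.card = s.var 2 ∨ ∀ c : Fin m, (c : ℕ) < j → c ∈ W)) (by decide) ?_ ?_
    · exact ⟨S, subset_rfl, h.of_frame (by simp) (by simp) (by simp) (by simp) (by simp)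
        (by simp), by simpa using h26, hS, by simp⟩
    · rintro j r hjm hj hv _ ⟨W, hSW, hH, h26r, hle, hor⟩
      rw [h.cands] at hjm
      let c₀ : Fin m := ⟨j, hjm⟩
      have h2r : r.var 2 = s.var 2 := hv 2 (by decide)
      have hav : r.arr 1 0 j = if c₀ ∈ W then 1 else 0 := hH.avail c₀
      by_cases hc₀ : c₀ ∈ W
      · refine ⟨W, hSW, hH.of_frame ?_ ?_ ?_ ?_ ?_ ?_, ?_, hle, hor.imp_right fun hall c hc => ?_⟩
        iterate 7 simp [run_ite, tick_var, hH.zero, hj, hav, hc₀, h26r]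
        rcases eq_or_ne (c : ℕ) j with h | h
        · rwa [show c = c₀ from Fin.ext h]
        · exact hall c (by omega)
      by_cases hk : W.card = s.var 2
      · refine ⟨W, hSW, hH.of_frame ?_ ?_ ?_ ?_ ?_ ?_, ?_, hle, Or.inl hk⟩
        iterate 7 simp [run_ite, tick_var, hH.zero, hj, hav, hc₀, h26r, h2r, hk]
      · have hlt : W.card < s.var 2 := lt_of_le_of_ne hle hk
        have hne : s.var 2 - W.card ≠ 0 := by omega
        refine ⟨insert c₀ W, hSW.trans (Finset.subset_insert _ _), ⟨?_, ?_, ?_, ?_, ?_, ?_⟩, ?_,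
          ?_, hor.imp (fun h => absurd h hk) fun hall c hc => ?_⟩
        · simp [run_ite, tick_var, hH.zero, hj, hav, hc₀, h26r, h2r, hne, hH.cands]
        · simp [run_ite, tick_var, hH.zero, hj, hav, hc₀, h26r, h2r, hne, hH.rows]
        · simp [run_ite, tick_var, hH.zero, hj, hav, hc₀, h26r, h2r, hne]
        · simp [run_ite, tick_var, hH.zero, hj, hav, hc₀, h26r, h2r, hne, hH.one]
        · intro v c
          rw [← hH.ballots v c]
          simp [run_ite, hH.zero, hj, hav, hc₀, h26r, h2r, hne]
        · intro c
          have hc : (c : ℕ) = j ↔ c = c₀ := by simp [c₀, Fin.ext_iff]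
          by_cases hcc : c = c₀
          · simp [run_ite, hH.zero, hj, hav, hc₀, h26r, h2r, hne, hH.one, hcc, c₀]
          · have hcj : (c : ℕ) ≠ j := fun h => hcc (hc.1 h)
            simp [run_ite, hH.zero, hj, hav, hc₀, h26r, h2r, hne, hcj, hcc, hH.avail]
        · rw [Finset.card_insert_of_notMem hc₀]
          simp [run_ite, tick_var, hH.zero, hj, hav, hc₀, h26r, h2r, hne, hH.one]
        · rw [Finset.card_insert_of_notMem hc₀]
          exact hlt
        · rcases eq_or_ne (c : ℕ) j with h | h
          · rw [show c = c₀ from Fin.ext h]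
            exact Finset.mem_insert_self _ _
          · exact Finset.mem_insert_of_mem (hall c (by omega))
  obtain ⟨W, hSW, hH, -, hle, hor⟩ := key
  refine ⟨W, hSW, hH, hor.elim id fun hall => le_antisymm hle ?_⟩
  have : W = Finset.univ := Finset.eq_univ_of_forall fun c => hall c (by rw [h.cands]; exact c.2)
  rw [this]
  simpa using hm

/-- An optimal committee is written to row `0` of array `1`. -/
def optimize : Cmd := findGoal ;; prune ;; countAvail ;; fill

theorem Holds.output_eq {n m : ℕ} {A : Fin n → Finset (Fin m)} {S : Finset (Fin m)}
    {s : State} (h : Holds A S s) : output m s = S := by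
  ext c
  simp [output, h.avail]

theorem Holds.run_optimize {n m : ℕ} {A : Fin n → Finset (Fin m)} {S : Finset (Fin m)}
    {s : State} {f : Fin m → ℝ} (hconv : ConvexBallots A S f) (h : Holds A S s)
    (ht : Tuned n m (s.var 2) s) (h22 : s.var 22 = n * s.var 8) (hm : s.var 2 ≤ m) :
    (output m (Cmd.run optimize s)).card = s.var 2 ∧
      ∀ U ⊆ S, U.card ≤ s.var 2 → coverage A U ≤ coverage A (output m (Cmd.run optimize s)) := by
  obtain ⟨t, h22₁, hcan, hmax⟩ := h.run_findGoal hconv ht h22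
  simp only [optimize, run_seq]
  set s₁ := Cmd.run findGoal s with hs₁
  have hv₁ : ∀ x ∈ [2, 8, 9, 19, 21], s₁.var x = s.var x := fun x hx =>
    run_var_of_notMem _ (by revert x; decide) s
  obtain ⟨W, hH₂, hWk, hWt⟩ := (h.run findGoal (by decide) (by decide)).run_prune hconv
    (ht.of_frame (hv₁ 8 (by decide)) (hv₁ 9 (by decide)) (hv₁ 19 (by decide))
      (hv₁ 21 (by decide))) (h22₁.trans (by rw [hv₁ 8 (by decide)])) hcan
  set s₂ := Cmd.run prune s₁ with hs₂
  set s₃ := Cmd.run countAvail s₂ with hs₃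
  have h2 : s₃.var 2 = s.var 2 := by
    rw [hs₃, run_var_of_notMem countAvail (by decide), hs₂, run_var_of_notMem prune (by decide),
      hv₁ 2 (by decide)]
  obtain ⟨W', hWW', hH₄, hcard⟩ := (hH₂.run countAvail (by decide) (by decide)).run_fill
    hH₂.run_countAvail (by rw [← hs₃, h2]; exact hWk) (by rw [← hs₃, h2]; exact hm)
  rw [hH₄.output_eq]
  exact ⟨hcard.trans h2, fun U hUS hUk =>
    (hmax U hUS hUk).trans (hWt.trans (coverage_mono A hWW'))⟩

/-! ### Setting the parameters -/

/-- `x` becomes `b * y`. -/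
def mul (x b y : ℕ) : Cmd := .const x 0 ;; .forLoop 10 b (.add x x y)

theorem run_mul {x b y : ℕ} (hx : x ≠ 3 ∧ x ≠ 10) (hb : b ≠ 3 ∧ b ≠ 10) (hy : y ≠ 3 ∧ y ≠ 10)
    (hxb : x ≠ b) (hxy : x ≠ y) (s : State) (z : ℕ) (hz : z ≠ 3 ∧ z ≠ 10) :
    (Cmd.run (mul x b y) s).var z = if z = x then s.var b * s.var y else s.var z := by
  split_ifs with hzx
  · subst hzx
    have := run_for_induct (i := 10) (b := b) (p := .add z z y) (s := s.setVar z 0)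
      (fun j r => r.var z = j * s.var y) ?_ ?_ ?_
    · rw [mul, run_seq, run_const]
      simpa [hxb.symm] using this
    · simp [LoopsOK, varsWritten, hb, hx.2.symm, hb.2.symm, hxb.symm]
    · simp [hx]
    · intro j r _ _ hv _ hI
      have hyr := hv y (by simp [varsWritten, hy, hxy.symm])
      simp [hxy.symm] at hyr
      simp [tick_var, hx, hI, hyr, Nat.succ_mul]
  · exact run_var_of_notMem _ (by simp [mul, varsWritten, hz, hzx]) s

/-- Variable `7` becomes `B = n + m + 1`. -/
def setBase : Cmd := .add 7 4 1 ;; .add 7 7 6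

/-- Powers of the number `B` in variable `7` serve as parameters of the descent: the tolerance
`B ^ 3`, the unit `N = B ^ 4` and the number `B ^ 9` of steps; the bound on the total weight is
`k * N + B - 1`, and the goal is to cover all ballots. -/
def setParams : Cmd :=
  mul 27 7 7 ;; mul 21 7 27 ;; mul 8 7 21 ;; mul 27 7 8 ;; mul 28 7 27 ;; mul 27 7 28 ;;
    mul 28 7 27 ;; mul 9 7 28 ;; mul 19 2 8 ;; .add 19 19 7 ;; .sub 19 19 6 ;; mul 22 4 8

theorem run_setParams (s : State) :
    (Cmd.run setParams s).var 21 = s.var 7 ^ 3 ∧ (Cmd.run setParams s).var 8 = s.var 7 ^ 4 ∧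
      (Cmd.run setParams s).var 9 = s.var 7 ^ 9 ∧
      (Cmd.run setParams s).var 19 = s.var 2 * s.var 7 ^ 4 + s.var 7 - s.var 6 ∧
      (Cmd.run setParams s).var 22 = s.var 4 * s.var 7 ^ 4 := by
  have h19 : s.var 2 * s.var 7 ^ 4 =
      s.var 2 * (s.var 7 * (s.var 7 * (s.var 7 * s.var 7))) := by ring
  refine ⟨?_, ?_, ?_, ?_, ?_⟩
  · simp [setParams, run_mul]
    ring
  · simp [setParams, run_mul]
    ring
  · simp [setParams, run_mul]
    ring
  · simp [setParams, run_mul, h19]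
  · simp [setParams, run_mul, -mul_eq_mul_left_iff]
    ring

/-- From a memory that holds a profile, an optimal committee is computed. -/
def solve : Cmd := setBase ;; setParams ;; optimize

theorem run_setBase {n m : ℕ} {A : Fin n → Finset (Fin m)} {S : Finset (Fin m)} {s : State}
    (h : Holds A S s) : (Cmd.run setBase s).var 7 = n + m + 1 := by
  simp [setBase, h.rows, h.cands, h.one]

theorem Holds.run_solve {n m : ℕ} {A : Fin n → Finset (Fin m)} {S : Finset (Fin m)}
    {s : State} {f : Fin m → ℝ} (hconv : ConvexBallots A S f) (h : Holds A S s)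
    (hk : 1 ≤ s.var 2) (hm : s.var 2 ≤ m) :
    (output m (Cmd.run solve s)).card = s.var 2 ∧
      ∀ U ⊆ S, U.card ≤ s.var 2 → coverage A U ≤ coverage A (output m (Cmd.run solve s)) := by
  rw [solve, run_seq, run_seq]
  have h7 := run_setBase h
  have hH₁ := h.run setBase (by decide) (by decide)
  have h2₁ := run_var_of_notMem setBase (x := 2) (by decide) s
  generalize Cmd.run setBase s = s₁ at *
  have hH₂ := hH₁.run setParams (by decide) (by decide)
  have h2 := run_var_of_notMem setParams (x := 2) (by decide) s₁
  rw [h2₁] at h2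
  obtain ⟨h21, h8, h9, h19, h22⟩ := run_setParams s₁
  generalize Cmd.run setParams s₁ = s₂ at *
  rw [h7] at h21 h8 h9 h19 h22
  rw [h2₁, hH₁.one] at h19
  rw [hH₁.rows] at h22
  have hB : 2 ≤ n + m + 1 := by omega
  have ht : Tuned n m (s₂.var 2) s₂ := by
    rw [h2]
    refine ⟨⟨n + m + 1, ?_, by omega, ?_⟩, ?_, ?_, ?_⟩
    · rw [h19, h8]
      omega
    · rw [h21, h8]
      have h1 : (n + m + 1) * n ≤ (n + m + 1) ^ 3 :=
        calc (n + m + 1) * n ≤ (n + m + 1) * (n + m + 1) := Nat.mul_le_mul_left _ (by omega)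
          _ = (n + m + 1) ^ 2 := (sq _).symm
          _ ≤ _ := Nat.pow_le_pow_right (by omega) (by omega)
      calc (n + m + 1) ^ 3 + (n + m + 1) * n ≤ (n + m + 1) ^ 3 * 2 := by omega
        _ ≤ (n + m + 1) ^ 3 * (n + m + 1) := Nat.mul_le_mul_left _ hB
        _ = _ := (pow_succ _ 3).symm
    · rw [h21]
      calc m * n ^ 2 ≤ (n + m + 1) * (n + m + 1) ^ 2 :=
            Nat.mul_le_mul (by omega) (Nat.pow_le_pow_left (by omega) 2)
        _ = _ := (pow_succ' _ 2).symm
    · rw [h21]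
      positivity
    · rw [h8, h9, ← pow_mul]
      calc s.var 2 * (n + m + 1) ^ (4 * 2) < (n + m + 1) * (n + m + 1) ^ (4 * 2) :=
            Nat.mul_lt_mul_of_pos_right (by omega) (by positivity)
        _ = _ := (pow_succ' _ _).symm
  have := hH₂.run_optimize hconv ht (by rw [h22, h8]) (by rw [h2]; exact hm)
  rwa [h2] at this

open Polynomial in
/-- A bound on the number of steps of `solve`, as a polynomial in a bound on its loop bounds. -/
noncomputable def solveTime : ℕ[X] := setBase.time + (setParams.time + optimize.time)

theorem exec_solve {n m V : ℕ} {A : Fin n → Finset (Fin m)} {S : Finset (Fin m)} {s : State}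
    (h : Holds A S s) (hm : s.var 2 ≤ m)
    (hV : (n + m + 1) ^ 9 ≤ V) :
    ∃ t, t ≤ solveTime.eval V ∧
      Exec (compile solve) s t (Cmd.run solve s) := by
  rw [solve, compile, compile, run_seq, run_seq]
  have hBV : n + m + 1 ≤ V := (Nat.le_self_pow (by omega) _).trans hV
  have h7 := run_setBase h
  have hH₁ := h.run setBase (by decide) (by decide)
  have h2 := run_var_of_notMem setBase (x := 2) (by decide) s
  obtain ⟨t₁, ht₁, e₁⟩ := exec_compile setBase (by decide) V s (by simp [setBase, bounds])
  generalize Cmd.run setBase s = s₁ at *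
  have hH₂ := hH₁.run setParams (by decide) (by decide)
  have h9 := (run_setParams s₁).2.2.1
  rw [h7] at h9
  obtain ⟨t₂, ht₂, e₂⟩ := exec_compile setParams (by decide) V s₁ (by
    have hb : ∀ b ∈ setParams.bounds,
        b ∉ setParams.varsWritten ∧ (b = 2 ∨ b = 4 ∨ b = 7) := by decide
    intro b hbm
    refine ⟨(hb b hbm).1, ?_⟩
    rcases (hb b hbm).2 with rfl | rfl | rfl
    · omega
    · rw [hH₁.rows]; omega
    · omega)
  generalize Cmd.run setParams s₁ = s₂ at *
  obtain ⟨t₃, ht₃, e₃⟩ := exec_compile optimize (by decide) V s₂ (by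
    have hb : ∀ b ∈ optimize.bounds,
        b ∉ optimize.varsWritten ∧ (b = 1 ∨ b = 4 ∨ b = 9) := by decide
    intro b hbm
    refine ⟨(hb b hbm).1, ?_⟩
    rcases (hb b hbm).2 with rfl | rfl | rfl
    · rw [hH₂.cands]; omega
    · rw [hH₂.rows]; omega
    · omega)
  refine ⟨t₁ + (t₂ + t₃), ?_, ?_⟩
  · simp only [solveTime, Polynomial.eval_add]
    omega
  · exact .seq e₁ (.seq e₂ e₃)

/-- It suffices to transform the election, in polynomial time, into a profile that has an
ordering of the available candidates with convex ballots, and whose optimal committees are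
optimal for the election. -/
theorem computableInPolyTime_of_reduction
    {D : ∀ {n m : ℕ}, (Fin n → Finset (Fin m)) → Prop}
    {Good : ∀ {n m : ℕ}, Election (Fin n) (Fin m) → Finset (Fin m) → Prop}
    (p : Cmd) (hp : p.LoopsOK) (hbounds : ∀ b ∈ p.bounds, b ∉ p.varsWritten ∧ (b = 0 ∨ b = 1))
    (h2 : 2 ∉ p.varsWritten) (P : Polynomial ℕ)
    (h : ∀ (n m : ℕ) (E : Election (Fin n) (Fin m)), D E.A →
      ∃ (r : ℕ) (A : Fin r → Finset (Fin m)) (S : Finset (Fin m)) (f : Fin m → ℝ),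
        r + m + 1 ≤ P.eval (n + m) ∧ ConvexBallots A S f ∧ Holds A S (p.run (input E)) ∧
        ∀ W : Finset (Fin m), W.card = E.k →
          (∀ U ⊆ S, U.card ≤ E.k → coverage A U ≤ coverage A W) → Good E W) :
    ComputableInPolyTime D Good := by
  refine ⟨.seq (compile p) (compile solve), p.time + solveTime.comp (P ^ 9), ?_⟩
  intro n m E hD
  obtain ⟨r, A, S, f, hP, hconv, hH, hgood⟩ := h n m E hD
  have hk : (p.run (input E)).var 2 = E.k := run_var_of_notMem p h2 _
  have hkm : E.k ≤ m := by simpa using E.k_le_card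
  obtain ⟨t₁, ht₁, e₁⟩ := exec_compile p hp (n + m) (input E) (by
    intro b hb
    refine ⟨(hbounds b hb).1, ?_⟩
    rcases (hbounds b hb).2 with rfl | rfl <;> simp [input])
  obtain ⟨t₂, ht₂, e₂⟩ := exec_solve hH (by rw [hk]; exact hkm) (V := (P ^ 9).eval (n + m))
    (by rw [Polynomial.eval_pow]; exact Nat.pow_le_pow_left hP 9)
  refine ⟨t₁ + t₂, _, .seq e₁ e₂, ?_, ?_⟩
  · rw [Polynomial.eval_add, Polynomial.eval_comp]
    omega
  · have := hH.run_solve hconv (by rw [hk]; exact E.one_le_k) (by rw [hk]; exact hkm)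
    rw [hk] at this
    exact hgood _ this.1 this.2

/-! ### The Chamberlin-Courant score in the candidate interval domain -/

/-- The ballot of voter `13` in the approval matrix is copied to array `2`. -/
def copyRow : Cmd := .forLoop 10 1 (.load 12 0 13 10 ;; .store 2 13 10 12)

theorem run_copyRow (s : State) (v c : ℕ) : (Cmd.run copyRow s).arr 2 v c =
    if v = s.var 13 ∧ c < s.var 1 then s.arr 0 v c else s.arr 2 v c := by
  revert v c
  refine run_for_induct (fun j r => ∀ v c, r.arr 2 v c =
    if v = s.var 13 ∧ c < j then s.arr 0 v c else s.arr 2 v c) (by decide) (by simp) ?_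
  intro j r _ hj hv ha hI v c
  have h13 := hv 13 (by decide)
  have h0 := ha 0 (by decide)
  by_cases hvv : v = s.var 13
  · rcases lt_trichotomy c j with h | h | h
    · simp [hj, h13, h0, hI, hvv, h, h.ne, Nat.lt_succ_of_lt h]
    · simp [hj, h13, h0, hvv, h]
    · simp [hj, h13, hI, hvv, h.ne', h.not_gt, Nat.not_le_of_lt h]
  · simp [hj, h13, hI, hvv]

/-- The whole election becomes the profile to be optimized. -/
def initCC : Cmd :=
  .const 6 1 ;; .add 4 0 5 ;; .forLoop 10 1 (.store 1 5 10 6) ;; .forLoop 13 0 copyRow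

theorem holds_run_initCC {n m : ℕ} (E : Election (Fin n) (Fin m)) :
    Holds E.A Finset.univ (Cmd.run initCC (input E)) := by
  set s := ((input E).setVar 6 1).setVar 4 n with hs
  have h0 : Cmd.run initCC (input E) =
      Cmd.run (.forLoop 13 0 copyRow) (Cmd.run (.forLoop 10 1 (.store 1 5 10 6)) s) := by
    simp [initCC, hs, input]
  set s₁ := Cmd.run (.forLoop 10 1 (.store 1 5 10 6)) s with hs₁
  have hone : ∀ c < s.var 1, s₁.arr 1 0 c = 1 := by
    refine run_for_induct (fun j r => ∀ c < j, r.arr 1 0 c = 1) (by decide) (by simp) ?_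
    intro j r _ hj hv _ hI c hc
    have h5 := hv 5 (by decide)
    have h6 := hv 6 (by decide)
    simp [hs, input] at h5 h6
    rcases eq_or_ne c j with rfl | hne
    · simp [hj, h5, h6]
    · simp [hj, h5, h6, hne, hI c (by omega)]
  have hcopy : ∀ v < s₁.var 0, ∀ c < s₁.var 1,
      (Cmd.run (.forLoop 13 0 copyRow) s₁).arr 2 v c = s₁.arr 0 v c := by
    refine run_for_induct (s := s₁) (fun j r => ∀ v < j, ∀ c < s₁.var 1,
      r.arr 2 v c = s₁.arr 0 v c) (by decide) (by simp) ?_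
    intro j r _ hj hv ha hI v hvj c hc
    have h1 := hv 1 (by decide)
    have h0 := ha 0 (by decide)
    rw [tick_arr, run_copyRow, hj, h1, h0]
    by_cases h : v = j
    · simp [h, hc]
    · simpa [h] using hI v (by omega) c hc
  rw [h0]
  have hv : ∀ x ∈ [0, 1, 4, 5, 6], s₁.var x = s.var x := fun x hx =>
    run_var_of_notMem _ (by revert x; decide) s
  have hv' : ∀ x ∈ [1, 4, 5, 6], (Cmd.run (.forLoop 13 0 copyRow) s₁).var x = s.var x :=
    fun x hx => (run_var_of_notMem _ (by revert x; decide) s₁).trans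
      (hv x (by revert x; decide))
  refine ⟨?_, ?_, ?_, ?_, ?_, ?_⟩
  · rw [hv' 1 (by decide)]; simp [hs, input]
  · rw [hv' 4 (by decide)]; simp [hs]
  · rw [hv' 5 (by decide)]; simp [hs, input]
  · rw [hv' 6 (by decide)]; simp [hs]
  · intro v c
    rw [hcopy v (by rw [hv 0 (by decide)]; simp [hs, input])
      c (by rw [hv 1 (by decide)]; simp [hs, input]), hs₁, run_arr_of_notMem _ (by decide)]
    simp [hs, input]
  · intro c
    rw [run_arr_of_notMem _ (by decide), hone c (by simp [hs, input])]
    simp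

theorem computableInPolyTime_cc :
    ComputableInPolyTime (fun A => IsCI A) (fun E W => E.IsMaximizer E.cc W) := by
  refine computableInPolyTime_of_reduction initCC (by decide) (by decide) (by decide)
    (Polynomial.X + 1) ?_
  intro n m E hE
  obtain ⟨f, hf⟩ := hE.exists_convexBallots
  refine ⟨n, E.A, Finset.univ, f, by simp, by simpa using hf, holds_run_initCC E, ?_⟩
  exact fun W hW hmax => ⟨hW, fun U hU => hmax U (Finset.subset_univ _) hU⟩

/-! ### The Pairs score in the voter-candidate interval domain -/

/-- The profile whose voters are the pairs of voters of `A`, in lexicographic order. The ballot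
of `(u, v)` is `A u ∩ A v` if `u < v` and empty otherwise, so that every two-element set of
voters is counted once. -/
def pairProfile {n m : ℕ} (A : Fin n → Finset (Fin m)) : Fin (n * n) → Finset (Fin m) :=
  fun r => if r.divNat < r.modNat then A r.divNat ∩ A r.modNat else ∅

theorem coverage_pairProfile {n m : ℕ} (E : Election (Fin n) (Fin m)) (W : Finset (Fin m)) :
    coverage (pairProfile E.A) W = E.pairs W := by
  unfold coverage Election.pairs
  refine Finset.card_bij (fun r _ => {r.divNat, r.modNat}) ?_ ?_ ?_
  · intro r hr
    replace hr := (Finset.mem_filter.1 hr).2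
    unfold pairProfile at hr
    split_ifs at hr with hlt
    · simp only [Finset.mem_filter, Finset.mem_powersetCard, Finset.subset_univ, true_and]
      exact ⟨Finset.card_pair hlt.ne, _, _, rfl, hr⟩
    · simp at hr
  · intro r hr q hq h
    replace hr := (Finset.mem_filter.1 hr).2
    replace hq := (Finset.mem_filter.1 hq).2
    unfold pairProfile at hr hq
    split_ifs at hr hq with hr' hq' <;> try simp at hr hq
    have h1 : r.divNat = q.divNat ∧ r.modNat = q.modNat := by
      have hmem : ∀ x, x ∈ ({r.divNat, r.modNat} : Finset (Fin n)) ↔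
          x ∈ ({q.divNat, q.modNat} : Finset (Fin n)) := fun x => by rw [h]
      simp only [Finset.mem_insert, Finset.mem_singleton] at hmem
      have a1 := (hmem r.divNat).1 (Or.inl rfl)
      have a2 := (hmem r.modNat).1 (Or.inr rfl)
      have a3 := (hmem q.divNat).2 (Or.inl rfl)
      omega
    exact finProdFinEquiv.symm.injective (Prod.ext h1.1 h1.2)
  · intro p hp
    simp only [Finset.mem_filter, Finset.mem_powersetCard, Finset.subset_univ,
      true_and] at hp
    obtain ⟨hp, u, v, rfl, hne⟩ := hp
    have huv : u ≠ v := fun h => by simp [h] at hp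
    have key : ∀ u v : Fin n, u < v → (E.A u ∩ E.A v ∩ W).Nonempty →
        ∃ r, ∃ (_ : r ∈ Finset.univ.filter (fun r => (pairProfile E.A r ∩ W).Nonempty)),
          ({r.divNat, r.modNat} : Finset (Fin n)) = {u, v} := by
      intro u v huv hne
      have h := finProdFinEquiv.symm_apply_apply (u, v)
      have h1 : (finProdFinEquiv (u, v)).divNat = u := congrArg Prod.fst h
      have h2 : (finProdFinEquiv (u, v)).modNat = v := congrArg Prod.snd h
      refine ⟨finProdFinEquiv (u, v), ?_, by rw [h1, h2]⟩
      rw [Finset.mem_filter, pairProfile, h1, h2, if_pos huv]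
      exact ⟨Finset.mem_univ _, hne⟩
    rcases lt_or_gt_of_ne huv with h | h
    · exact key u v h hne
    · rw [Finset.pair_comm]
      exact key v u h (by rwa [Finset.inter_comm (E.A v)])

theorem ConvexBallots.pairProfile {n m : ℕ} {A : Fin n → Finset (Fin m)} {S : Set (Fin m)}
    {f : Fin m → ℝ} (h : ConvexBallots A S f) : ConvexBallots (pairProfile A) S f := by
  intro r i hi j hj k hk hir hkr hij hjk
  unfold RAM.pairProfile at hir hkr ⊢
  split_ifs at hir hkr ⊢
  · rw [Finset.mem_inter] at hir hkr ⊢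
    exact ⟨h _ i hi j hj k hk hir.1 hkr.1 hij hjk, h _ i hi j hj k hk hir.2 hkr.2 hij hjk⟩
  · simp at hir

/-- Replacing dominated candidates by undominated ones that dominate them does not
decrease the Pairs score. -/
theorem exists_undominated_pairs_le {n m : ℕ} (E : Election (Fin n) (Fin m))
    (U : Finset (Fin m)) :
    ∃ U' : Finset (Fin m), (∀ c ∈ U', ¬ IsDominated E.A c) ∧ U'.card ≤ U.card ∧
      E.pairs U ≤ E.pairs U' := by
  choose g hg using exists_not_isDominated_supporters_subset E.A
  refine ⟨U.image g, ?_, Finset.card_image_le, ?_⟩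
  · intro c hc
    obtain ⟨d, -, rfl⟩ := Finset.mem_image.1 hc
    exact (hg d).1
  · refine Finset.card_le_card fun p hp => ?_
    simp only [Finset.mem_filter] at hp ⊢
    obtain ⟨hp, u, v, rfl, c, hc⟩ := hp
    simp only [Finset.mem_inter] at hc
    refine ⟨hp, u, v, rfl, g c, ?_⟩
    simp only [Finset.mem_inter]
    exact ⟨⟨(hg c).2 hc.1.1, (hg c).2 hc.1.2⟩, Finset.mem_image_of_mem g hc.2⟩

/-- Variables `15` and `16` tell whether all voters approving candidate `13` approve candidate
`14`, and whether some voter approves `14` and not `13`. -/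
def compareCands : Cmd :=
  .const 15 1 ;; .const 16 0 ;; .forLoop 10 0 (.load 11 0 10 13 ;; .load 12 0 10 14 ;;
    .ite 11 (.ite 12 .skip (.const 15 0)) (.ite 12 (.const 16 1) .skip))

theorem run_compareCands (s : State) :
    ((Cmd.run compareCands s).var 15 ≠ 0 ↔
        ∀ v < s.var 0, s.arr 0 v (s.var 13) ≠ 0 → s.arr 0 v (s.var 14) ≠ 0) ∧
      ((Cmd.run compareCands s).var 16 ≠ 0 ↔
        ∃ v < s.var 0, s.arr 0 v (s.var 13) = 0 ∧ s.arr 0 v (s.var 14) ≠ 0) := by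
  rw [compareCands, run_seq, run_seq]
  refine run_for_induct (fun j r =>
    (r.var 15 ≠ 0 ↔ ∀ v < j, s.arr 0 v (s.var 13) ≠ 0 → s.arr 0 v (s.var 14) ≠ 0) ∧
    (r.var 16 ≠ 0 ↔ ∃ v < j, s.arr 0 v (s.var 13) = 0 ∧ s.arr 0 v (s.var 14) ≠ 0))
    (by decide) (by simp) ?_
  rintro j r _ hj hv ha ⟨h1, h2⟩
  have h13 := hv 13 (by decide)
  have h14 := hv 14 (by decide)
  have h0 := ha 0 (by decide)
  simp at h13 h14 h0
  rw [Nat.forall_lt_succ_right, Nat.exists_lt_succ_right, ← h1, ← h2]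
  by_cases hd : s.arr 0 j (s.var 13) = 0 <;> by_cases hc : s.arr 0 j (s.var 14) = 0 <;>
    simp [run_ite, tick_var, hj, h13, h14, h0, hd, hc]

/-- Candidate `13` is made unavailable if it is dominated. -/
def testDominated : Cmd :=
  .store 1 5 13 6 ;; .forLoop 14 1 (compareCands ;;
    .ite 15 (.ite 16 (.store 1 5 13 5) .skip) .skip)

open Classical in
theorem run_testDominated {n m : ℕ} {A : Fin n → Finset (Fin m)} {s : State} (d : Fin m)
    (h0 : s.var 0 = n) (h1 : s.var 1 = m) (h5 : s.var 5 = 0) (h6 : s.var 6 = 1)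
    (hd : s.var 13 = d) (hA : ∀ (v : Fin n) (c : Fin m), s.arr 0 v c ≠ 0 ↔ c ∈ A v) (c : ℕ) :
    (Cmd.run testDominated s).arr 1 0 c =
      if c = d then (if IsDominated A d then 0 else 1) else s.arr 1 0 c := by
  have key : (Cmd.run testDominated s).arr 1 0 c = if c = d then
      (if ∃ e : Fin m, (e : ℕ) < s.var 1 ∧ supporters A d ⊂ supporters A e then 0 else 1)
      else s.arr 1 0 c := by
    rw [testDominated, run_seq]
    refine run_for_induct (fun j r => r.arr 1 0 c = if c = d then
      (if ∃ e : Fin m, (e : ℕ) < j ∧ supporters A d ⊂ supporters A e then 0 else 1)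
      else s.arr 1 0 c) (by decide) ?_ ?_
    · simp [h5, h6, hd]
    · intro j r hjm hj hv ha hI
      have h0r := hv 0 (by decide)
      have h5r := hv 5 (by decide)
      have h13r := hv 13 (by decide)
      have ha0 := ha 0 (by decide)
      simp [h0, h5, hd, h1] at h0r h5r h13r ha0 hjm
      let e₀ : Fin m := ⟨j, hjm⟩
      obtain ⟨hsub, hprop⟩ := run_compareCands r
      rw [h0r, h13r, hj, ha0] at hsub hprop
      have hsub' : (Cmd.run compareCands r).var 15 ≠ 0 ↔
          supporters A d ⊆ supporters A e₀ := by
        rw [hsub]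
        constructor
        · intro h v hv
          exact (hA v e₀).1 (h v v.2 ((hA v d).2 hv))
        · intro h v hv hvd
          exact (hA ⟨v, hv⟩ e₀).2 (h ((hA ⟨v, hv⟩ d).1 hvd))
      have hprop' : (Cmd.run compareCands r).var 16 ≠ 0 ↔
          ¬ supporters A e₀ ⊆ supporters A d := by
        rw [hprop, Set.not_subset]
        constructor
        · rintro ⟨v, hv, hvd, hve⟩
          exact ⟨⟨v, hv⟩, (hA ⟨v, hv⟩ e₀).1 hve, fun h => (hA ⟨v, hv⟩ d).2 h hvd⟩
        · rintro ⟨v, hve, hvd⟩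
          exact ⟨v, v.2, by_contra fun h => hvd ((hA v d).1 h), (hA v e₀).2 hve⟩
      have hex : (∃ e : Fin m, (e : ℕ) < j + 1 ∧ supporters A d ⊂ supporters A e) ↔
          (∃ e : Fin m, (e : ℕ) < j ∧ supporters A d ⊂ supporters A e) ∨
            supporters A d ⊂ supporters A e₀ := by
        constructor
        · rintro ⟨e, he, h⟩
          rcases eq_or_ne (e : ℕ) j with hej | hej
          · right
            rwa [show e₀ = e from Fin.ext hej.symm]
          · exact Or.inl ⟨e, by omega, h⟩
        · rintro (⟨e, he, h⟩ | h)
          · exact ⟨e, by omega, h⟩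
          · exact ⟨e₀, Nat.lt_succ_self j, h⟩
      have h5q : (Cmd.run compareCands r).var 5 = 0 := by
        rw [run_var_of_notMem compareCands (by decide), h5r]
      have h13q : (Cmd.run compareCands r).var 13 = d := by
        rw [run_var_of_notMem compareCands (by decide), h13r]
      have ha1q : (Cmd.run compareCands r).arr 1 = r.arr 1 :=
        run_arr_of_notMem compareCands (by decide) r
      rw [tick_arr, run_seq, run_ite]
      by_cases hs : supporters A d ⊆ supporters A e₀
      · rw [if_pos (hsub'.2 hs), run_ite]
        by_cases hp : supporters A e₀ ⊆ supporters A d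
        · rw [if_neg (fun h => hprop'.1 h hp)]
          have : ¬ supporters A d ⊂ supporters A e₀ := fun h => h.2 hp
          simp only [hex, this, or_false, run_skip, ha1q]
          exact hI
        · rw [if_pos (hprop'.2 hp)]
          have : supporters A d ⊂ supporters A e₀ := ⟨hs, hp⟩
          simp only [hex, this, or_true, if_true, run_store, State.setArr_arr, h5q, h13q,
            ha1q, true_and]
          by_cases hcd : c = d
          · simp [hcd]
          · simpa [hcd] using hI
      · rw [if_neg (fun h => hs (hsub'.1 h))]
        have : ¬ supporters A d ⊂ supporters A e₀ := fun h => hs h.1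
        simp only [hex, this, or_false, run_skip, ha1q]
        exact hI
  rw [key]
  have : (∃ e : Fin m, (e : ℕ) < s.var 1 ∧ supporters A d ⊂ supporters A e) ↔
      IsDominated A d := by
    rw [h1]
    exact ⟨fun ⟨e, _, h⟩ => ⟨e, h⟩, fun ⟨e, h⟩ => ⟨e, e.2, h⟩⟩
  simp only [this]

/-- The ballot of the pair of voters `13` and `14` is written to row `4` of array `2`. -/
def pairRow : Cmd :=
  .forLoop 10 1 (.const 17 0 ;; .load 11 0 13 10 ;; .load 12 0 14 10 ;;
    .ite 11 (.ite 12 (.sub 17 14 13) .skip) .skip ;; .store 2 4 10 17)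

/-- The matrix entry that `pairRow` writes for the voters `u`, `v` and the candidate `c`. -/
def pairEntry (s : State) (u v c : ℕ) : ℕ :=
  if s.arr 0 u c ≠ 0 ∧ s.arr 0 v c ≠ 0 then v - u else 0

theorem run_pairRow (s : State) (r c : ℕ) : (Cmd.run pairRow s).arr 2 r c =
    if r = s.var 4 ∧ c < s.var 1 then pairEntry s (s.var 13) (s.var 14) c
    else s.arr 2 r c := by
  revert r c
  refine run_for_induct (fun j q => ∀ r c, q.arr 2 r c =
    if r = s.var 4 ∧ c < j then pairEntry s (s.var 13) (s.var 14) c else s.arr 2 r c)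
    (by decide) (by simp) ?_
  intro j q _ hj hv ha hI r c
  have h4 := hv 4 (by decide)
  have h13 := hv 13 (by decide)
  have h14 := hv 14 (by decide)
  have h0 := ha 0 (by decide)
  have hstep : (tick 10 1 (Cmd.run (.const 17 0 ;; .load 11 0 13 10 ;; .load 12 0 14 10 ;;
      .ite 11 (.ite 12 (.sub 17 14 13) .skip) .skip ;; .store 2 4 10 17) q)).arr 2 r c =
      if r = s.var 4 ∧ c = j then pairEntry s (s.var 13) (s.var 14) j else q.arr 2 r c := by
    unfold pairEntry
    by_cases hu : s.arr 0 (s.var 13) j = 0 <;> by_cases hw : s.arr 0 (s.var 14) j = 0 <;>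
      simp [run_ite, hj, h4, h13, h14, h0, hu, hw]
  rw [hstep, hI]
  by_cases hr : r = s.var 4
  · rcases lt_trichotomy c j with h | h | h
    · simp [hr, h, h.ne, Nat.lt_succ_of_lt h]
    · simp [hr, h]
    · simp [hr, h.ne', h.not_gt, Nat.not_le_of_lt h]
  · simp [hr]

/-- The rows for all pairs of voters with first voter `13` are written. -/
def pairRows : Cmd := .forLoop 14 0 (pairRow ;; .add 4 4 6)

/-- The first rows of array `2`, as many as variable `4` says, are those of the pair profile. -/
def PairRowsDone (s r : State) : Prop :=
  ∀ i < r.var 4, ∀ c < s.var 1, r.arr 2 i c = pairEntry s (i / s.var 0) (i % s.var 0) c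

theorem run_pairRows {s₀ s : State} {u : ℕ} (h0 : s.var 0 = s₀.var 0) (h1 : s.var 1 = s₀.var 1)
    (h6 : s.var 6 = 1) (ha0 : s.arr 0 = s₀.arr 0) (h13 : s.var 13 = u)
    (h4 : s.var 4 = u * s₀.var 0) (hdone : PairRowsDone s₀ s) :
    (Cmd.run pairRows s).var 4 = (u + 1) * s₀.var 0 ∧
      PairRowsDone s₀ (Cmd.run pairRows s) := by
  rw [Nat.succ_mul, ← h0]
  refine run_for_induct (fun j r => r.var 4 = u * s.var 0 + j ∧ PairRowsDone s₀ r)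
    (by decide) ⟨by simp [h4, h0], by simpa [PairRowsDone] using hdone⟩ ?_
  rintro j r hjn hj hv ha ⟨h4r, hI⟩
  have h13r := hv 13 (by decide)
  have h6r := hv 6 (by decide)
  have h1r := hv 1 (by decide)
  have h0r := ha 0 (by decide)
  have h4' : (tick 14 0 (Cmd.run (pairRow ;; .add 4 4 6) r)).var 4 = u * s.var 0 + j + 1 := by
    simp [tick_var, run_var_of_notMem pairRow (x := 4) (by decide),
      run_var_of_notMem pairRow (x := 6) (by decide), h4r, h6r, h6]
  refine ⟨h4', ?_⟩
  intro i hi c hc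
  rw [h4'] at hi
  simp only [tick_arr, run_seq, run_add, State.setVar_arr]
  rw [run_pairRow, h4r]
  by_cases hij : i = u * s.var 0 + j
  · rw [if_pos ⟨hij, by rw [h1r, h1]; exact hc⟩, hj, h13r, h13, ← h0]
    have hpos : 0 < s.var 0 := by omega
    have hdiv : i / s.var 0 = u := by
      rw [hij, Nat.mul_comm, Nat.mul_add_div hpos, Nat.div_eq_of_lt hjn, Nat.add_zero]
    have hmod : i % s.var 0 = j := by
      rw [hij, Nat.mul_comm, Nat.mul_add_mod, Nat.mod_eq_of_lt hjn]
    rw [hdiv, hmod, pairEntry, pairEntry, h0r, ha0]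
  · rw [if_neg (fun h => hij h.1)]
    exact hI i (by omega) c hc

/-- The pair profile and the undominated candidates become the profile to be optimized. -/
def initPairs : Cmd :=
  .const 6 1 ;; .forLoop 13 1 testDominated ;; .forLoop 13 0 pairRows

open Classical in
theorem holds_run_initPairs {n m : ℕ} (E : Election (Fin n) (Fin m)) :
    Holds (pairProfile E.A) (Finset.univ.filter (fun c => ¬ IsDominated E.A c))
      (Cmd.run initPairs (input E)) := by
  rw [initPairs, run_seq, run_seq, run_const]
  set s := (input E).setVar 6 1 with hs
  have hs0 : s.var 0 = n := by simp [hs, input]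
  have hs1 : s.var 1 = m := by simp [hs, input]
  have hs4 : s.var 4 = 0 := by simp [hs, input]
  have hs5 : s.var 5 = 0 := by simp [hs, input]
  have hs6 : s.var 6 = 1 := by simp [hs]
  have hsA : ∀ (v : Fin n) (c : Fin m), s.arr 0 v c ≠ 0 ↔ c ∈ E.A v := by
    intro v c
    simp [hs, input]
  set s₁ := Cmd.run (.forLoop 13 1 testDominated) s with hs₁
  have hdom : ∀ d : Fin m, (d : ℕ) < s.var 1 →
      s₁.arr 1 0 d = if IsDominated E.A d then 0 else 1 := by
    refine run_for_induct (s := s) (fun j r => ∀ d : Fin m, (d : ℕ) < j →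
      r.arr 1 0 d = if IsDominated E.A d then 0 else 1) (by decide) (by simp) ?_
    intro j r hjm hj hv ha hI d hdj
    rw [hs1] at hjm
    rw [tick_arr, run_testDominated (A := E.A) ⟨j, hjm⟩ ((hv 0 (by decide)).trans hs0)
      ((hv 1 (by decide)).trans hs1) ((hv 5 (by decide)).trans hs5)
      ((hv 6 (by decide)).trans hs6) hj (by rw [ha 0 (by decide)]; exact hsA)]
    rcases eq_or_ne (d : ℕ) j with h | h
    · rw [if_pos h, show d = ⟨j, hjm⟩ from Fin.ext h]
    · rw [if_neg h]
      exact hI d (by omega)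
  have hv : ∀ x ∈ [0, 1, 4, 5, 6], s₁.var x = s.var x := fun x hx =>
    run_var_of_notMem _ (by revert x; decide) s
  have ha₁ : s₁.arr 0 = s.arr 0 := run_arr_of_notMem _ (by decide) s
  obtain ⟨h4, hrows⟩ : (Cmd.run (.forLoop 13 0 pairRows) s₁).var 4 = s₁.var 0 * s₁.var 0 ∧
      PairRowsDone s₁ (Cmd.run (.forLoop 13 0 pairRows) s₁) := by
    refine run_for_induct (s := s₁) (fun j r => r.var 4 = j * s₁.var 0 ∧ PairRowsDone s₁ r)
      (by decide) ?_ ?_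
    · have : s₁.var 4 = 0 := (hv 4 (by decide)).trans hs4
      exact ⟨by simp [this], by simp [PairRowsDone, this]⟩
    · rintro j r _ hj hvr har ⟨h4r, hI⟩
      have := run_pairRows (hvr 0 (by decide)) (hvr 1 (by decide))
        ((hvr 6 (by decide)).trans ((hv 6 (by decide)).trans hs6)) (har 0 (by decide)) hj h4r hI
      simpa [PairRowsDone, tick_var] using this
  have hv' : ∀ x ∈ [1, 5, 6], (Cmd.run (.forLoop 13 0 pairRows) s₁).var x = s.var x :=
    fun x hx => (run_var_of_notMem _ (by revert x; decide) s₁).trans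
      (hv x (by revert x; decide))
  have hs₁0 : s₁.var 0 = n := (hv 0 (by decide)).trans hs0
  have hs₁1 : s₁.var 1 = m := (hv 1 (by decide)).trans hs1
  refine ⟨(hv' 1 (by decide)).trans hs1, by rw [h4, hs₁0], (hv' 5 (by decide)).trans hs5,
    (hv' 6 (by decide)).trans hs6, ?_, ?_⟩
  · intro r c
    rw [hrows r (by rw [h4, hs₁0]; exact r.2) c (by rw [hs₁1]; exact c.2), hs₁0, pairEntry, ha₁]
    have h1 := hsA r.divNat c
    have h2 := hsA r.modNat c
    rw [Fin.coe_divNat] at h1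
    rw [Fin.coe_modNat] at h2
    simp only [h1, h2, pairProfile]
    by_cases hlt : (r : ℕ) / n < r % n
    · have hlt' : r.divNat < r.modNat := hlt
      rw [if_pos hlt', Finset.mem_inter]
      split_ifs with h
      · simp only [h, and_self, iff_true]
        omega
      · simp [h]
    · have hlt' : ¬ r.divNat < r.modNat := hlt
      rw [if_neg hlt']
      have : (r : ℕ) % n - r / n = 0 := by omega
      simp [this]
  · intro c
    rw [run_arr_of_notMem _ (by decide), hdom c (by rw [hs1]; exact c.2)]
    by_cases h : IsDominated E.A c <;> simp [h]

theorem computableInPolyTime_pairs :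
    ComputableInPolyTime (fun A => IsVCI A) (fun E W => E.IsMaximizer E.pairs W) := by
  classical
  refine computableInPolyTime_of_reduction initPairs (by decide) (by decide) (by decide)
    (Polynomial.X ^ 2 + Polynomial.X + 1) ?_
  intro n m E hE
  obtain ⟨f, hf⟩ := hE.exists_convexBallots
  refine ⟨n * n, pairProfile E.A, Finset.univ.filter (fun c => ¬ IsDominated E.A c), f, ?_,
    by simpa using ConvexBallots.pairProfile hf, holds_run_initPairs E, ?_⟩
  · simp only [Polynomial.eval_add, Polynomial.eval_pow, Polynomial.eval_X, Polynomial.eval_one]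
    nlinarith
  · intro W hW hmax
    refine ⟨hW, fun U hU => ?_⟩
    obtain ⟨U', hU', hcard, hle⟩ := exists_undominated_pairs_le E U
    have := hmax U' (fun c hc => by simpa using hU' c hc) (hcard.trans hU)
    rw [coverage_pairProfile, coverage_pairProfile] at this
    exact hle.trans this

end RAM

theorem mainTheorem4 :
    -- in the VCI domain, a committee maximizing Pairs is computable in polynomial time
    RAM.ComputableInPolyTime (fun A => IsVCI A) (fun E W => E.IsMaximizer E.pairs W) ∧
    -- removing the dominated candidates from a VCI profile yields a CI profile
    (∀ {V : Type*} {C : Type*} [Fintype V] [Fintype C] (A : V → Finset C),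
      IsVCI A → IsCI (removeDominated A)) ∧
    -- the Pairs score is the CC score on the pair instance
    (∀ {V : Type*} {C : Type*} [Fintype V] [Fintype C] [DecidableEq V] [DecidableEq C]
      (E : Election V C) (W : Finset C), E.pairs W = E.pairInstance.cc W) ∧
    -- the pair instance of a CI election is CI
    (∀ {V : Type*} {C : Type*} [Fintype V] [Fintype C] [DecidableEq V] [DecidableEq C]
      (E : Election V C), IsCI E.A → IsCI E.pairInstance.A) ∧
    -- in the CI domain, a committee maximizing CC is computable in polynomial time
    RAM.ComputableInPolyTime (fun A => IsCI A) (fun E W => E.IsMaximizer E.cc W) := by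
  exact ⟨RAM.computableInPolyTime_pairs, fun _ h => h.isCI_removeDominated,
    fun E W => E.pairs_eq_cc_pairInstance W, fun E h => E.isCI_pairInstance h,
    RAM.computableInPolyTime_cc⟩
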